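/- Let $e_1,\dots,e_6$ be the standard basis of $\mathbb{R}^6$, $\mathbf 1=\sum_i e_i$, $e_{ijk}=\frac13(e_i+e_j+e_k)$ for distinct $i,j,k$, and $f_m=\frac15(\mathbf 1-e_m)$. Put $V_1=\{e_i\}$, $V_3=\{e_{ijk}\}$ (20 points), $V_5=\{f_m\}$. Let $X_6=\partial\Delta^5$ be the boundary complex of the simplex $\Delta^5=[e_1,\dots,e_6]$. Distinct letters below always denote distinct indices in $\{1,\dots,6\}$, $*$ denotes the join and $\partial$ the boundary. (1) Starring the six facets of $X_6$ at their barycentres $f_m$ gives the complex $X_{12}$ with vertex set $V_1\cup V_5$ and facets $[e_i,e_j,e_k,e_l,f_m]$; it is a geometric simplicial complex in $\mathbb{R}^6$ subdividing $\partial\Delta^5$. (2) In each facet $[e_i,e_j,e_k,e_l,f_m]$ of $X_{12}$ cut the tetrahedron $[e_i,e_j,e_k,e_l]$ into eleven tetrahedra: the six $[e_i,e_j,e_{ijk},e_{ijl}]$ (one for each edge), the four $[e_i,e_{ijk},e_{ijl},e_{ikl}]$ (one for each vertex) and $[e_{ijk},e_{ijl},e_{ikl},e_{jkl}]$; join each of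 them with $f_m$. The resulting complex $X_{32}$ is a geometric simplicial complex in $\mathbb{R}^6$ that subdivides $X_{12}$, has underlying space $\partial\Delta^5$ and the 32 vertices $V_1\cup V_3\cup V_5$, and is a triangulated $S^4$. (3) In $X_{32}$, the bistellar flips that replace $[e_i,e_j,f_k]*\partial[e_{ijl},e_{ijl'},e_{ijl''}]$ by $[e_{ijl},e_{ijl'},e_{ijl''}]*\partial[e_i,e_j,f_k]$, where $\{i,j,k,l,l',l''\}=\{1,\dots,6\}$, can all be performed simultaneously. In the result, the bistellar flips that replace $[e_i,e_j]*\partial[e_{ijl},e_{ijl'},e_{ijl''},e_{ijl'''}]$ by $[e_{ijl},e_{ijl'},e_{ijl''},e_{ijl'''}]*\partial[e_i,e_j]$ can all be performed simultaneously. (Simultaneously means: in every order, each flip being admissible when its turn comes, always with the same result.) These two rounds give a triangulated $S^4$ on the same 32 vertices, $S^4_{32}$, whose 300 facets are exactly the simplices $[e_i,e_{ijl},e_{ijl'},e_{ijl''},e_{ijl'''}]$ (30 in number), $[f_m,e_{ijk},e_{ijl},e_{ikl},e_{jkl}]$ (30), $[e_i,f_k,e_{ijl},e_{ijl'},e_{ijl''}]$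 (120) and $[e_i,f_m,e_{ijk},e_{ijl},e_{ikl}]$ (120). (4) The involution $\sigma$ of the vertices with $e_i\leftrightarrow\frac15(\mathbf 1-e_i)$ and $e_{ijk}\leftrightarrow\frac13(\mathbf 1-e_i-e_j-e_k)$ is an automorphism of $S^4_{32}$ that is link-separating: each vertex $v$ has distance at least $3$ from $\sigma(v)$ in the 1-skeleton. The group $S_6$, permuting the coordinates of $\mathbb{R}^6$, acts on $S^4_{32}$ by automorphisms, which commute with $\sigma$. (5) The quotient complex $S^4_{32}/\langle\sigma\rangle$ is a triangulation of $\mathbb{R}P^4$ with 16 vertices and 150 facets, all of them 4-simplices. The induced action of $S_6$ on it by automorphisms is faithful, has exactly two orbits of vertices, the images of $V_1\cup V_5$ (6 vertices) and of $V_3$ (10 vertices), and exactly two orbits of facets, of sizes 30 and 120. (6) $S^4_{32}/\langle\sigma\rangle$ is isomorphic to Lutz's complex $\mathbb{R}P^4_{16}$, that is, to the complex on the vertices $1,2,\dots,9,a=10,b=11,\dots,g=16$ with the following 150 facets: 1245b, 1245e, 124bd, 124de, 125bf, 125ef, 1278d, 1278f, 127de, 127ef, 128bd, 128bf, 134ad,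 134ag, 134bd, 134bg, 1389b, 1389c, 138bd, 138cd, 139bg, 139cg, 13acd, 13acg, 145bg, 145eg, 14ade, 14aeg, 1569f, 1569g, 156ef, 156eg, 159bf, 159bg, 167ac, 167ae, 167cf, 167ef, 169cf, 169cg, 16acg, 16aeg, 178cd, 178cf, 17acd, 17ade, 189bf, 189cf, 235ac, 235af, 235ce, 235ef, 2379e, 2379g, 237ef, 237fg, 239ce, 239cg, 23acg, 23afg, 245bc, 245ce, 2469c, 2469d, 246bc, 246bd, 249ce, 249de, 25abc, 25abf, 268ab, 268ag, 268bd, 268dg, 269cg, 269dg, 26abc, 26acg, 278dg, 278fg, 279de, 279dg, 28abf, 28afg, 3467b, 3467f, 346bd, 346df, 347bg, 347fg, 34adf, 34afg, 3568d, 3568e, 356df, 356ef, 358cd, 358ce, 35acd, 35adf, 367be, 367ef, 368bd, 368be, 379be, 379bg, 389be, 389ce, 4578c, 4578g, 457bc, 457bg, 458ce, 458eg, 467bc, 467cf, 469cf, 469df, 478cf, 478fg, 489ae, 489af, 489ce, 489cf, 48aeg, 48afg, 49ade, 49adf, 568dg, 568eg, 569df, 569dg, 578cd, 578dg, 579ab,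 579ad, 579bg, 579dg, 57abc, 57acd, 59abf, 59adf, 67abc, 67abe, 68abe, 68aeg, 79abe, 79ade, 89abe, 89abf. -/

import Mathlib

open Function

namespace RP416

/-! ### Finite abstract simplicial complexes

Complexes are Mathlib's `PreAbstractSimplicialComplex V`: downward closed families of nonempty
finite subsets of a type `V` of labels; an element `v` is a vertex when `{v}` is a face. -/

section Complexes

variable {V W : Type*} [DecidableEq V] [DecidableEq W]

/-- The complex whose faces are the nonempty subsets of the members of `F`. -/
def generatedBy (F : Set (Finset V)) : PreAbstractSimplicialComplex V where
  faces := {s | s.Nonempty ∧ ∃ t ∈ F, s ⊆ t}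
  isRelLowerSet_faces := by
    rintro s ⟨hs, t, ht, hst⟩
    exact ⟨hs, fun u hu hne => ⟨hne, t, ht, hu.trans hst⟩⟩

/-- The vertices of a complex. -/
def vertices (K : PreAbstractSimplicialComplex V) : Set V := {v | {v} ∈ K.faces}

/-- The facets of a complex: its maximal faces. -/
def facets (K : PreAbstractSimplicialComplex V) : Set (Finset V) :=
  {s | s ∈ K.faces ∧ ∀ t ∈ K.faces, s ⊆ t → s = t}

/-- Isomorphism of complexes: a bijection between the vertices that carries the faces of the first
complex exactly to the faces of the second. -/
def Isomorphic (K : PreAbstractSimplicialComplex V) (L : PreAbstractSimplicialComplex W) : Prop :=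
  ∃ φ : V → W, Set.InjOn φ (vertices K) ∧ K.map φ = L

/-- The geometric realization (for finitely many labels): the points of the simplex spanned by the
labels, written in barycentric coordinates, whose support is contained in a face. -/
def realization [Finite V] (K : PreAbstractSimplicialComplex V) : Set (V → ℝ) :=
  {x | (∀ v, 0 ≤ x v) ∧ ∃ s ∈ K.faces, (∀ v, v ∉ s → x v = 0) ∧ ∑ v ∈ s, x v = 1}

/-- The 1-skeleton of a complex, as a graph on its labels. -/
def skeletonGraph (K : PreAbstractSimplicialComplex V) : SimpleGraph V where
  Adj v w := v ≠ w ∧ {v, w} ∈ K.faces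
  symm := ⟨fun v w h => ⟨h.1.symm, by rw [Finset.pair_comm]; exact h.2⟩⟩
  loopless := ⟨fun _ h => h.1 rfl⟩

/-- `K` is antipodal under `σ`, that is, `σ` is a link-separating involution of `K`: it is an
involution that maps `K` onto itself, and in the 1-skeleton of `K` each vertex `v` has distance at
least `3` from `σ v` (infinite distance being allowed). -/
structure IsAntipodal (K : PreAbstractSimplicialComplex V) (σ : V → V) : Prop where
  involutive : Involutive σ
  invariant : K.map σ = K
  three_le_edist : ∀ v ∈ vertices K, 3 ≤ (skeletonGraph K).edist v (σ v)

/-- The bistellar flip that replaces the join of the simplex `A` and the boundary of the simplex `B`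
by the join of `B` and the boundary of `A`. It is a flip only when `FlipAdmissible K A B`. -/
def flip (K : PreAbstractSimplicialComplex V) (A B : Finset V) :
    PreAbstractSimplicialComplex V where
  faces := {s | ¬ A ⊆ s ∧ (s ∈ K.faces ∨ (s.Nonempty ∧ s ⊆ A ∪ B))}
  isRelLowerSet_faces := by
    rintro s ⟨hA, h⟩
    rcases h with h | ⟨hs, h⟩
    · exact ⟨(K.isRelLowerSet_faces h).1, fun t hts ht =>
        ⟨fun h' => hA (h'.trans hts), Or.inl ((K.isRelLowerSet_faces h).2 hts ht)⟩⟩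
    · exact ⟨hs, fun t hts ht => ⟨fun h' => hA (h'.trans hts), Or.inr ⟨ht, hts.trans h⟩⟩⟩

/-- The flip at `(A, B)` may be performed in `K`: `A` is a face, `B` is a simplex on other labels
that is not a face, and the link of `A` in `K` is the boundary complex of `B`. -/
structure FlipAdmissible (K : PreAbstractSimplicialComplex V) (A B : Finset V) : Prop where
  mem : A ∈ K.faces
  nonempty : B.Nonempty
  disjoint : Disjoint A B
  notMem : B ∉ K.faces
  link : ∀ t : Finset V,
    (t.Nonempty ∧ Disjoint t A ∧ t ∪ A ∈ K.faces) ↔ (t.Nonempty ∧ t ⊂ B)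

/-- Performing the listed flips one after the other, starting from `K`, is admissible at each step
and ends with `L`. -/
def FlipsTo (K : PreAbstractSimplicialComplex V) :
    List (Finset V × Finset V) → PreAbstractSimplicialComplex V → Prop
  | [], L => K = L
  | p :: l, L => FlipAdmissible K p.1 p.2 ∧ FlipsTo (flip K p.1 p.2) l L

/-- `L` arises from `K` by simultaneous bistellar flips at all the pairs in `F`: the flips can be
performed in every order, each of them being admissible when its turn comes, always with the
result `L`. -/
def SimultaneousFlip (K : PreAbstractSimplicialComplex V) (F : Finset (Finset V × Finset V))
    (L : PreAbstractSimplicialComplex V) : Prop :=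
  ∀ l : List (Finset V × Finset V), l.Nodup → l.toFinset = F → FlipsTo K l L

end Complexes

/-! ### Quotients by involutions, the 4-sphere and real projective 4-space -/

/-- The equivalence relation whose classes are the orbits of an involution. -/
def involutionSetoid {X : Type*} (σ : X → X) (hσ : Involutive σ) : Setoid X where
  r x y := y = x ∨ y = σ x
  iseqv :=
    { refl := fun _ => Or.inl rfl
      symm := by
        rintro x y (rfl | rfl)
        · exact Or.inl rfl
        · exact Or.inr (hσ x).symm
      trans := by
        rintro x y z (rfl | rfl) (rfl | rfl)
        · exact Or.inl rfl
        · exact Or.inr rfl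
        · exact Or.inr rfl
        · exact Or.inl (hσ x) }

instance {X : Type*} [DecidableEq X] (σ : X → X) (hσ : Involutive σ) (x y : X) :
    Decidable ((involutionSetoid σ hσ).r x y) :=
  inferInstanceAs (Decidable (y = x ∨ y = σ x))

instance {X : Type*} [DecidableEq X] (σ : X → X) (hσ : Involutive σ) :
    DecidableEq (Quotient (involutionSetoid σ hσ)) :=
  @Quotient.decidableEq X (involutionSetoid σ hσ)
    fun x y => inferInstanceAs (Decidable ((involutionSetoid σ hσ).r x y))

/-- The standard 4-sphere in Euclidean 5-space. -/
abbrev Sphere4 : Type := Metric.sphere (0 : EuclideanSpace ℝ (Fin 5)) 1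

/-- Real projective 4-space: the 4-sphere with antipodal points identified (quotient topology). -/
abbrev RealProjective4 : Type :=
  Quotient (involutionSetoid (fun x : Sphere4 => -x) neg_involutive)

/-! ### The points of the construction

Coordinates of `ℝ⁶` are indexed by `Fin 6`. A nonempty set `S` of coordinates is a label for the
barycentre of the face of the standard 5-simplex spanned by the `e_i`, `i ∈ S`. So `{i}` is the
label of `e_i`, `{i, j, k}` that of `(e_i + e_j + e_k) / 3`, and `{i}ᶜ` that of `(1 - e_i) / 5`. -/

/-- Labels for points of `ℝ⁶`; the complexes below use only those with 1, 3 or 5 elements. -/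
abbrev Label : Type := Finset (Fin 6)

/-- The point with a given label. -/
noncomputable def point (S : Label) : Fin 6 → ℝ := (S.card : ℝ)⁻¹ • ∑ i ∈ S, Pi.single i 1

/-- The sets `V₁`, `V₃` and `V₅` of vertices, for `n = 1, 3, 5`. -/
def verticesOfCard (n : ℕ) : Set Label := {S | S.card = n}

/-- The boundary of the standard 5-simplex in `ℝ⁶`. -/
def boundarySimplex : Set (Fin 6 → ℝ) := {x | x ∈ stdSimplex ℝ (Fin 6) ∧ ∃ i, x i = 0}

/-- The simplices spanned by the points of the faces of `K` form a geometric simplicial complex in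
`ℝ⁶` with underlying space `T`, distinct vertices being distinct points. -/
def TriangulatesByPoints (K : PreAbstractSimplicialComplex Label) (T : Set (Fin 6 → ℝ)) : Prop :=
  Set.InjOn point (vertices K) ∧
  ∃ G : Geometry.SimplicialComplex ℝ (Fin 6 → ℝ),
    G.toPreAbstractSimplicialComplex = K.map point ∧ G.space = T

/-- Each simplex of `K` (spanned by the points of its labels) lies in a simplex of `L`. -/
def RefinesByPoints (K L : PreAbstractSimplicialComplex Label) : Prop :=
  ∀ s ∈ K.faces, ∃ t ∈ L.faces,
    convexHull ℝ (point '' (s : Set Label)) ⊆ convexHull ℝ (point '' (t : Set Label))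

/-! ### The complexes of the construction -/

/-- The boundary complex of the 5-simplex. -/
def X6 : PreAbstractSimplicialComplex Label :=
  generatedBy {s | ∃ i : Fin 6, s = (Finset.univ.erase i).image fun j => {j}}

/-- The complex with the facets `[e_i, e_j, e_k, e_l, (1 - e_m) / 5]`. -/
def X12 : PreAbstractSimplicialComplex Label :=
  generatedBy {s | ∃ i j k l m : Fin 6, [i, j, k, l, m].Nodup ∧
    s = {{i}, {j}, {k}, {l}, {m}ᶜ}}

/-- The facets of `X12` subdivided by the barycentres of the triangles of the 5-simplex: for each
facet `[e_i, e_j, e_k, e_l, (1 - e_m) / 5]`, the eleven tetrahedra into which its tetrahedron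
`[e_i, e_j, e_k, e_l]` is cut (six at the edges, four at the vertices, one in the middle) are
joined with `(1 - e_m) / 5`. -/
def X32 : PreAbstractSimplicialComplex Label :=
  generatedBy
    ({s | ∃ i j k l m : Fin 6, [i, j, k, l, m].Nodup ∧
        s = {{i}, {j}, {i, j, k}, {i, j, l}, {m}ᶜ}} ∪
      {s | ∃ i j k l m : Fin 6, [i, j, k, l, m].Nodup ∧
        s = {{i}, {i, j, k}, {i, j, l}, {i, k, l}, {m}ᶜ}} ∪
      {s | ∃ i j k l m : Fin 6, [i, j, k, l, m].Nodup ∧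
        s = {{i, j, k}, {i, j, l}, {i, k, l}, {j, k, l}, {m}ᶜ}})

/-- The stellar subdivisions of the facets of `X6` at their barycentres, as flips of a facet against
a new vertex. -/
def facetStarrings : Finset (Finset Label × Finset Label) :=
  Finset.univ.image fun i : Fin 6 => ((Finset.univ.erase i).image fun j => {j}, {{i}ᶜ})

/-- First round of flips: the triangle `[e_i, e_j, (1 - e_k) / 5]` against the triangle of the three
points `(e_i + e_j + e_l) / 3` with `l ≠ i, j, k`, for all distinct `i, j, k`. -/
def firstFlips : Finset (Finset Label × Finset Label) :=
  (Finset.univ.filter fun p : Fin 6 × Fin 6 × Fin 6 => [p.1, p.2.1, p.2.2].Nodup).image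
    fun p => ({{p.1}, {p.2.1}, {p.2.2}ᶜ},
      (Finset.univ \ {p.1, p.2.1, p.2.2}).image fun l => {p.1, p.2.1, l})

/-- Second round of flips: the edge `[e_i, e_j]` against the tetrahedron of the four points
`(e_i + e_j + e_l) / 3` with `l ≠ i, j`, for all distinct `i, j`. -/
def secondFlips : Finset (Finset Label × Finset Label) :=
  (Finset.univ.filter fun p : Fin 6 × Fin 6 => p.1 ≠ p.2).image
    fun p => ({{p.1}, {p.2}},
      (Finset.univ \ {p.1, p.2}).image fun l => {p.1, p.2, l})

/-- The first type of facets of `S432`. -/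
def facetType1 : Set (Finset Label) :=
  {s | ∃ i j l₁ l₂ l₃ l₄ : Fin 6, [i, j, l₁, l₂, l₃, l₄].Nodup ∧
    s = {{i}, {i, j, l₁}, {i, j, l₂}, {i, j, l₃}, {i, j, l₄}}}

/-- The second type of facets of `S432`. -/
def facetType2 : Set (Finset Label) :=
  {s | ∃ i j k l m : Fin 6, [i, j, k, l, m].Nodup ∧
    s = {{m}ᶜ, {i, j, k}, {i, j, l}, {i, k, l}, {j, k, l}}}

/-- The third type of facets of `S432`. -/
def facetType3 : Set (Finset Label) :=
  {s | ∃ i j k l₁ l₂ l₃ : Fin 6, [i, j, k, l₁, l₂, l₃].Nodup ∧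
    s = {{i}, {k}ᶜ, {i, j, l₁}, {i, j, l₂}, {i, j, l₃}}}

/-- The fourth type of facets of `S432`. -/
def facetType4 : Set (Finset Label) :=
  {s | ∃ i j k l m : Fin 6, [i, j, k, l, m].Nodup ∧
    s = {{i}, {m}ᶜ, {i, j, k}, {i, j, l}, {i, k, l}}}

/-- The antipodal 4-sphere with 32 vertices. -/
def S432 : PreAbstractSimplicialComplex Label :=
  generatedBy (facetType1 ∪ facetType2 ∪ facetType3 ∪ facetType4)

/-- The antipodal map on labels: `e_i ↔ (1 - e_i) / 5`, and
`(e_i + e_j + e_k) / 3 ↔ (1 - e_i - e_j - e_k) / 3`. -/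
def antipode (S : Label) : Label := Sᶜ

theorem antipode_involutive : Involutive antipode := fun S => compl_compl S

/-- The action of a permutation of the coordinates on labels. -/
def permLabel (g : Equiv.Perm (Fin 6)) (S : Label) : Label := S.map g.toEmbedding

/-- Labels for the vertices of the quotient: antipodal pairs of labels. -/
abbrev QuotientLabel : Type := Quotient (involutionSetoid antipode antipode_involutive)

/-- The pair of a label and its antipode. -/
def toQuotient (S : Label) : QuotientLabel := Quotient.mk _ S

/-- The quotient of `S432` by the antipodal map. -/
def quotientS432 : PreAbstractSimplicialComplex QuotientLabel := S432.map toQuotient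

/-! ### Lutz's complex -/

/-- The facets of Lutz's 16-vertex triangulation of real projective 4-space, with the vertices
numbered `1, …, 16`. -/
def lutzFacets : List (Finset ℕ) :=
  [
    {1, 2, 4, 5, 11}, {1, 2, 4, 5, 14}, {1, 2, 4, 11, 13}, {1, 2, 4, 13, 14}, {1, 2, 5, 11, 15},
    {1, 2, 5, 14, 15}, {1, 2, 7, 8, 13}, {1, 2, 7, 8, 15}, {1, 2, 7, 13, 14}, {1, 2, 7, 14, 15},
    {1, 2, 8, 11, 13}, {1, 2, 8, 11, 15}, {1, 3, 4, 10, 13}, {1, 3, 4, 10, 16}, {1, 3, 4, 11, 13},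
    {1, 3, 4, 11, 16}, {1, 3, 8, 9, 11}, {1, 3, 8, 9, 12}, {1, 3, 8, 11, 13}, {1, 3, 8, 12, 13},
    {1, 3, 9, 11, 16}, {1, 3, 9, 12, 16}, {1, 3, 10, 12, 13}, {1, 3, 10, 12, 16}, {1, 4, 5, 11, 16},
    {1, 4, 5, 14, 16}, {1, 4, 10, 13, 14}, {1, 4, 10, 14, 16}, {1, 5, 6, 9, 15}, {1, 5, 6, 9, 16},
    {1, 5, 6, 14, 15}, {1, 5, 6, 14, 16}, {1, 5, 9, 11, 15}, {1, 5, 9, 11, 16}, {1, 6, 7, 10, 12},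
    {1, 6, 7, 10, 14}, {1, 6, 7, 12, 15}, {1, 6, 7, 14, 15}, {1, 6, 9, 12, 15}, {1, 6, 9, 12, 16},
    {1, 6, 10, 12, 16}, {1, 6, 10, 14, 16}, {1, 7, 8, 12, 13}, {1, 7, 8, 12, 15}, {1, 7, 10, 12, 13},
    {1, 7, 10, 13, 14}, {1, 8, 9, 11, 15}, {1, 8, 9, 12, 15}, {2, 3, 5, 10, 12}, {2, 3, 5, 10, 15},
    {2, 3, 5, 12, 14}, {2, 3, 5, 14, 15}, {2, 3, 7, 9, 14}, {2, 3, 7, 9, 16}, {2, 3, 7, 14, 15},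
    {2, 3, 7, 15, 16}, {2, 3, 9, 12, 14}, {2, 3, 9, 12, 16}, {2, 3, 10, 12, 16}, {2, 3, 10, 15, 16},
    {2, 4, 5, 11, 12}, {2, 4, 5, 12, 14}, {2, 4, 6, 9, 12}, {2, 4, 6, 9, 13}, {2, 4, 6, 11, 12},
    {2, 4, 6, 11, 13}, {2, 4, 9, 12, 14}, {2, 4, 9, 13, 14}, {2, 5, 10, 11, 12}, {2, 5, 10, 11, 15},
    {2, 6, 8, 10, 11}, {2, 6, 8, 10, 16}, {2, 6, 8, 11, 13}, {2, 6, 8, 13, 16}, {2, 6, 9, 12, 16},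
    {2, 6, 9, 13, 16}, {2, 6, 10, 11, 12}, {2, 6, 10, 12, 16}, {2, 7, 8, 13, 16}, {2, 7, 8, 15, 16},
    {2, 7, 9, 13, 14}, {2, 7, 9, 13, 16}, {2, 8, 10, 11, 15}, {2, 8, 10, 15, 16}, {3, 4, 6, 7, 11},
    {3, 4, 6, 7, 15}, {3, 4, 6, 11, 13}, {3, 4, 6, 13, 15}, {3, 4, 7, 11, 16}, {3, 4, 7, 15, 16},
    {3, 4, 10, 13, 15}, {3, 4, 10, 15, 16}, {3, 5, 6, 8, 13}, {3, 5, 6, 8, 14}, {3, 5, 6, 13, 15},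
    {3, 5, 6, 14, 15}, {3, 5, 8, 12, 13}, {3, 5, 8, 12, 14}, {3, 5, 10, 12, 13}, {3, 5, 10, 13, 15},
    {3, 6, 7, 11, 14}, {3, 6, 7, 14, 15}, {3, 6, 8, 11, 13}, {3, 6, 8, 11, 14}, {3, 7, 9, 11, 14},
    {3, 7, 9, 11, 16}, {3, 8, 9, 11, 14}, {3, 8, 9, 12, 14}, {4, 5, 7, 8, 12}, {4, 5, 7, 8, 16},
    {4, 5, 7, 11, 12}, {4, 5, 7, 11, 16}, {4, 5, 8, 12, 14}, {4, 5, 8, 14, 16}, {4, 6, 7, 11, 12},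
    {4, 6, 7, 12, 15}, {4, 6, 9, 12, 15}, {4, 6, 9, 13, 15}, {4, 7, 8, 12, 15}, {4, 7, 8, 15, 16},
    {4, 8, 9, 10, 14}, {4, 8, 9, 10, 15}, {4, 8, 9, 12, 14}, {4, 8, 9, 12, 15}, {4, 8, 10, 14, 16},
    {4, 8, 10, 15, 16}, {4, 9, 10, 13, 14}, {4, 9, 10, 13, 15}, {5, 6, 8, 13, 16}, {5, 6, 8, 14, 16},
    {5, 6, 9, 13, 15}, {5, 6, 9, 13, 16}, {5, 7, 8, 12, 13}, {5, 7, 8, 13, 16}, {5, 7, 9, 10, 11},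
    {5, 7, 9, 10, 13}, {5, 7, 9, 11, 16}, {5, 7, 9, 13, 16}, {5, 7, 10, 11, 12}, {5, 7, 10, 12, 13},
    {5, 9, 10, 11, 15}, {5, 9, 10, 13, 15}, {6, 7, 10, 11, 12}, {6, 7, 10, 11, 14}, {6, 8, 10, 11, 14},
    {6, 8, 10, 14, 16}, {7, 9, 10, 11, 14}, {7, 9, 10, 13, 14}, {8, 9, 10, 11, 14}, {8, 9, 10, 11, 15}]

/-- Lutz's 16-vertex triangulation of real projective 4-space. -/
def lutzRP416 : PreAbstractSimplicialComplex ℕ := generatedBy {s | s ∈ lutzFacets}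

end RP416

/-! The proof rests on convexity and on the symmetry under `S_6`. Modulo the diagonal, `ℝ⁶` becomes
`ℝ⁵`. The boundary of the simplex consists of the nonnegative points with coordinate sum 1 and some
coordinate 0, so it meets each ray of `ℝ⁵` in exactly one point. Triangulating it by given points
therefore amounts to finding a complete simplicial fan, and such a fan arises when the points, after
positive rescaling, are the vertices of a simplicial polytope with the right facets.

`IsPolytopal` is a finite certificate for this: a supporting functional for each facet and a
neighbour across each ridge. Neighbours give linear independence on a facet, supporting functionals
make nonnegative coordinates unique (`coeff_unique`), and maximising the functionals shows that
every point has such coordinates (`exists_coeff`). Hence radial projection is a homeomorphism onto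
`S^4`, and the cones cut the boundary of the simplex into a geometric complex. The scaling factors
depend only on the cardinality of a label, so `S_6` preserves the polytope and one representative of
each orbit of facets has to be checked (`isPolytopal_orbits`).

For `S432` the weights are invariant under complementation of labels. Indicators of complementary
sets add up to 1, which is zero modulo the diagonal, so the antipode acts on the polytope as `x ↦
-x`. A cardinality criterion for sharing a face (`Near`) shows that the antipode separates links.
Hence faces, and points of the realization, have the same image in the quotient complex only when
they are equal or antipodal, and the quotient is `ℝP⁴`.

Flips of one round commute because neither simplex of one pair lies in the ball of another
(`CompatibleFlips`); the result is described at once by `flipAll`, and symmetry again reduces the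
conditions to representatives. The isomorphism with Lutz's complex is an explicit numbering of
vertices: facets go to facets by evaluation, and counting to 150 gives equality. -/

namespace RP416

/-! ### Complexes whose faces span the boundary of a simplicial polytope -/

section Polytopal

variable {V E : Type*} [Fintype V] [NormedAddCommGroup E] [NormedSpace ℝ E]

/-- The sets in `𝓕` index the vertices of the facets of a simplicial polytope: each of them is cut
out by a supporting hyperplane, and one can leave it across each of its ridges. -/
structure IsPolytopal [DecidableEq V] (𝓕 : Set (Finset V)) (p : V → E) : Prop where
  support : ∀ F ∈ 𝓕, ∃ ℓ : E →ₗ[ℝ] ℝ, ∀ v, ℓ (p v) ≤ 1 ∧ (ℓ (p v) = 1 ↔ v ∈ F)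
  neighbor : ∀ F ∈ 𝓕, ∀ v ∈ F, ∃ G ∈ 𝓕, F.erase v ⊆ G ∧ v ∉ G
  card_eq : ∀ F ∈ 𝓕, F.card = Module.finrank ℝ E
  nonempty : 𝓕.Nonempty

namespace IsPolytopal

variable [DecidableEq V] {𝓕 : Set (Finset V)} {p : V → E}

/-- The difference of the functionals of `F` and of its neighbour opposite `v` vanishes on `F`
except at `v`, so it isolates the coefficient of `v`. -/
theorem eq_zero_of_sum_eq_zero (h : IsPolytopal 𝓕 p) {F : Finset V} (hF : F ∈ 𝓕) {c : V → ℝ}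
    (hc : ∀ v, v ∉ F → c v = 0) (h0 : ∑ v, c v • p v = 0) : c = 0 := by
  funext v
  by_cases hv : v ∈ F
  swap
  · exact hc v hv
  obtain ⟨G, hG, hFG, hvG⟩ := h.neighbor F hF v hv
  obtain ⟨ℓ, hℓ⟩ := h.support F hF
  obtain ⟨m, hm⟩ := h.support G hG
  have h1 := congrArg (ℓ - m) h0
  simp only [map_sum, map_smul, LinearMap.sub_apply, smul_eq_mul, map_zero] at h1
  rw [Finset.sum_eq_single v] at h1
  · rcases mul_eq_zero.1 h1 with h2 | h2
    · exact h2
    · exact absurd ((hm v).2.1 (by rw [← (hℓ v).2.2 hv]; linarith)) hvG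
  · intro u _ huv
    by_cases hu : u ∈ F
    · rw [(hℓ u).2.2 hu, (hm u).2.2 (hFG (Finset.mem_erase.2 ⟨huv, hu⟩))]; simp
    · rw [hc u hu, zero_mul]
  · simp

/-- On a nonnegative combination, a facet's functional is at most the coefficient sum, with equality
exactly when the combination is supported on that facet. Comparing both functionals on both
expressions forces all sums to agree, so `d` is also supported on `F`, where independence applies.
-/
theorem coeff_unique (h : IsPolytopal 𝓕 p) {F G : Finset V} (hF : F ∈ 𝓕) (hG : G ∈ 𝓕)
    {c d : V → ℝ} (hc0 : ∀ v, 0 ≤ c v) (hd0 : ∀ v, 0 ≤ d v) (hc : ∀ v, v ∉ F → c v = 0)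
    (hd : ∀ v, v ∉ G → d v = 0) (hcd : ∑ v, c v • p v = ∑ v, d v • p v) : c = d := by
  obtain ⟨ℓ, hℓ⟩ := h.support F hF
  obtain ⟨m, hm⟩ := h.support G hG
  have e1 := congrArg ℓ hcd
  have e2 := congrArg m hcd
  simp only [map_sum, map_smul, smul_eq_mul] at e1 e2
  have c1 : ∑ v, c v * ℓ (p v) = ∑ v, c v := Finset.sum_congr rfl fun v _ => by
    by_cases hv : v ∈ F
    · rw [(hℓ v).2.2 hv, mul_one]
    · rw [hc v hv, zero_mul]
  have d1 : ∑ v, d v * m (p v) = ∑ v, d v := Finset.sum_congr rfl fun v _ => by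
    by_cases hv : v ∈ G
    · rw [(hm v).2.2 hv, mul_one]
    · rw [hd v hv, zero_mul]
  have c2 : ∑ v, c v * m (p v) ≤ ∑ v, c v :=
    Finset.sum_le_sum fun v _ => mul_le_of_le_one_right (hc0 v) (hm v).1
  have d2 : ∑ v, d v * ℓ (p v) = ∑ v, d v :=
    le_antisymm (Finset.sum_le_sum fun v _ => mul_le_of_le_one_right (hd0 v) (hℓ v).1)
      (by linarith)
  have d3 := (Finset.sum_eq_sum_iff_of_le
    (fun v _ => mul_le_of_le_one_right (hd0 v) (hℓ v).1)).1 d2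
  have hdF : ∀ v, v ∉ F → d v = 0 := fun v hv => by
    by_contra hne
    exact hv ((hℓ v).2.1 (mul_left_cancel₀ hne ((d3 v (Finset.mem_univ v)).trans (mul_one _).symm)))
  have := h.eq_zero_of_sum_eq_zero hF (c := c - d)
    (fun v hv => by simp [hc v hv, hdF v hv]) (by simp [sub_smul, hcd])
  exact sub_eq_zero.1 this

/-- The facet met by the ray through `y` is one whose functional is maximal at `y`. If a coordinate
of `y` in the basis of that facet were negative, crossing the opposite ridge would increase the
functional. -/
theorem exists_coeff [FiniteDimensional ℝ E] (h : IsPolytopal 𝓕 p) (y : E) :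
    ∃ F ∈ 𝓕, ∃ c : V → ℝ, (∀ v, 0 ≤ c v) ∧ (∀ v, v ∉ F → c v = 0) ∧ ∑ v, c v • p v = y := by
  choose! ℓ hℓ using h.support
  obtain ⟨F, hF, hmax⟩ := Set.exists_max_image 𝓕 (fun F => ℓ F y) (Set.toFinite _) h.nonempty
  have hli : LinearIndependent ℝ (fun v : F => p v) := by
    rw [Fintype.linearIndependent_iff]
    intro g hg v
    have h0 := h.eq_zero_of_sum_eq_zero hF (c := fun v => if hv : v ∈ F then g ⟨v, hv⟩ else 0)
      (fun v hv => by simp [hv]) (by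
        rw [← hg, ← Finset.sum_subset (Finset.subset_univ F), ← Finset.sum_coe_sort]
        · exact Finset.sum_congr rfl fun v _ => by simp
        · intro v _ hv
          simp [hv])
    simpa using congrFun h0 v
  have hspan := hli.span_eq_top_of_card_eq_finrank' (by simpa using h.card_eq F hF)
  have hy : y ∈ Submodule.span ℝ (Set.range fun v : F => p v) := hspan ▸ Submodule.mem_top
  obtain ⟨g, hg⟩ := (Submodule.mem_span_range_iff_exists_fun ℝ).1 hy
  let c : V → ℝ := fun v => if hv : v ∈ F then g ⟨v, hv⟩ else 0
  have hc : ∀ v, v ∉ F → c v = 0 := fun v hv => by simp [c, hv]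
  have hcy : ∑ v, c v • p v = y := by
    rw [← hg, ← Finset.sum_subset (Finset.subset_univ F), ← Finset.sum_coe_sort]
    · exact Finset.sum_congr rfl fun v _ => by simp [c]
    · intro v _ hv
      simp [hc v hv]
  refine ⟨F, hF, c, fun v => ?_, hc, hcy⟩
  by_contra hneg
  have hv : v ∈ F := by
    by_contra hv
    exact hneg (hc v hv).ge
  obtain ⟨G, hG, hFG, hvG⟩ := h.neighbor F hF v hv
  -- The two functionals agree on the common ridge, so only the term of `v` survives.
  have key : (ℓ G - ℓ F) y = c v * (ℓ G (p v) - 1) := by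
    rw [← hcy]
    simp only [map_sum, map_smul, LinearMap.sub_apply, smul_eq_mul]
    rw [Finset.sum_eq_single v]
    · rw [(hℓ F hF v).2.2 hv]
    · intro u _ huv
      by_cases hu : u ∈ F
      · rw [(hℓ F hF u).2.2 hu, (hℓ G hG u).2.2 (hFG (Finset.mem_erase.2 ⟨huv, hu⟩))]; simp
      · rw [hc u hu, zero_mul]
    · simp
  have hlt : ℓ G (p v) < 1 := lt_of_le_of_ne (hℓ G hG v).1 fun he => hvG ((hℓ G hG v).2.1 he)
  have hmx := hmax G hG
  have : 0 < c v * (ℓ G (p v) - 1) := mul_pos_of_neg_of_neg (not_le.1 hneg) (by linarith)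
  rw [← key, LinearMap.sub_apply] at this
  linarith

end IsPolytopal

/-! ### Realizations and radial projection -/

theorem mem_realization_generatedBy {𝓕 : Set (Finset V)} {x : V → ℝ} :
    x ∈ realization (generatedBy 𝓕) ↔
      (∀ v, 0 ≤ x v) ∧ ∑ v, x v = 1 ∧ ∃ F ∈ 𝓕, ∀ v, v ∉ F → x v = 0 := by
  constructor
  · rintro ⟨h0, s, ⟨-, F, hF, hsF⟩, hs, h1⟩
    refine ⟨h0, ?_, F, hF, fun v hv => hs v fun h => hv (hsF h)⟩
    rw [← h1]
    exact (Finset.sum_subset (Finset.subset_univ s) fun v _ hv => hs v hv).symm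
  · rintro ⟨h0, h1, F, hF, h⟩
    have h2 : ∑ v ∈ F, x v = 1 := by
      rw [← h1]
      exact Finset.sum_subset (Finset.subset_univ F) fun v _ hv => h v hv
    refine ⟨h0, F, ⟨?_, F, hF, subset_rfl⟩, h, h2⟩
    rw [Finset.nonempty_iff_ne_empty]
    rintro rfl
    simp at h2

theorem isCompact_realization (K : PreAbstractSimplicialComplex V) : IsCompact (realization K) := by
  have hsub : realization K ⊆ Set.Icc (0 : V → ℝ) 1 := by
    rintro x ⟨h0, s, -, hs, h1⟩
    refine ⟨h0, fun v => ?_⟩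
    by_cases hv : v ∈ s
    · rw [Pi.one_apply, ← h1]
      exact Finset.single_le_sum (fun u _ => h0 u) hv
    · rw [hs v hv]
      exact zero_le_one
  refine isCompact_Icc.of_isClosed_subset ?_ hsub
  -- There are finitely many faces, so this is a finite union of closed sets.
  have : realization K = (⋂ v, {x : V → ℝ | 0 ≤ x v}) ∩
      ⋃ s ∈ K.faces, ((⋂ v, ⋂ _ : v ∉ s, {x : V → ℝ | x v = 0}) ∩ {x | ∑ v ∈ s, x v = 1}) := by
    ext x
    simp only [realization, Set.mem_ofPred_eq, Set.mem_inter_iff, Set.mem_iInter, Set.mem_iUnion,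
      exists_prop]
  rw [this]
  refine (isClosed_iInter fun v => isClosed_le continuous_const (continuous_apply v)).inter
    ((Set.toFinite _).isClosed_biUnion fun s _ => IsClosed.inter ?_ ?_)
  · exact isClosed_iInter fun v => isClosed_iInter fun _ =>
      isClosed_eq (continuous_apply v) continuous_const
  · exact isClosed_eq (continuous_finsetSum _ fun v _ => continuous_apply v) continuous_const

instance (K : PreAbstractSimplicialComplex V) : CompactSpace (realization K) :=
  isCompact_iff_compactSpace.1 (isCompact_realization K)

namespace IsPolytopal

variable [DecidableEq V] {𝓕 : Set (Finset V)} {p : V → E}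

theorem sum_smul_ne_zero (h : IsPolytopal 𝓕 p) {x : V → ℝ}
    (hx : x ∈ realization (generatedBy 𝓕)) : ∑ v, x v • p v ≠ 0 := by
  obtain ⟨-, h1, F, hF, hxF⟩ := mem_realization_generatedBy.1 hx
  intro h0
  rw [h.eq_zero_of_sum_eq_zero hF hxF h0] at h1
  simp at h1

/-- The radial projection of the boundary of a polytope to the unit sphere. -/
noncomputable def toSphere (h : IsPolytopal 𝓕 p) (x : realization (generatedBy 𝓕)) :
    Metric.sphere (0 : E) 1 :=
  ⟨‖∑ v, x.1 v • p v‖⁻¹ • ∑ v, x.1 v • p v, by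
    have := norm_ne_zero_iff.2 (h.sum_smul_ne_zero x.2)
    simp [norm_smul, this]⟩

theorem continuous_toSphere (h : IsPolytopal 𝓕 p) : Continuous h.toSphere := by
  have hc : Continuous fun x : realization (generatedBy 𝓕) => ∑ v, x.1 v • p v :=
    continuous_finsetSum _ fun v _ =>
      ((continuous_apply v).comp continuous_subtype_val).smul continuous_const
  exact Continuous.subtype_mk
    ((hc.norm.inv₀ fun x => norm_ne_zero_iff.2 (h.sum_smul_ne_zero x.2)).smul hc) _

theorem toSphere_bijective [FiniteDimensional ℝ E] (h : IsPolytopal 𝓕 p) :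
    Bijective h.toSphere := by
  constructor
  · rintro ⟨x, hx⟩ ⟨y, hy⟩ hxy
    have h0x := norm_pos_iff.2 (h.sum_smul_ne_zero hx)
    have h0y := norm_pos_iff.2 (h.sum_smul_ne_zero hy)
    obtain ⟨hx0, hx1, F, hF, hxF⟩ := mem_realization_generatedBy.1 hx
    obtain ⟨hy0, hy1, G, hG, hyG⟩ := mem_realization_generatedBy.1 hy
    have he := congrArg Subtype.val hxy
    simp only [toSphere] at he
    set a := ‖∑ v, x v • p v‖
    set b := ‖∑ v, y v • p v‖
    have hu := h.coeff_unique hF hG (c := a⁻¹ • x) (d := b⁻¹ • y)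
      (fun v => mul_nonneg (inv_nonneg.2 h0x.le) (hx0 v))
      (fun v => mul_nonneg (inv_nonneg.2 h0y.le) (hy0 v))
      (fun v hv => by simp [hxF v hv]) (fun v hv => by simp [hyG v hv])
      (by
        rw [Finset.smul_sum, Finset.smul_sum] at he
        simpa only [Pi.smul_apply, smul_eq_mul, mul_smul] using he)
    -- Both `x` and `y` have coordinate sum 1, so summing the coefficients compares the norms.
    have hab : a⁻¹ = b⁻¹ := by
      have := congrArg (fun f : V → ℝ => ∑ v, f v) hu
      simpa [← Finset.mul_sum, hx1, hy1] using this
    rw [hab] at hu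
    exact Subtype.ext (smul_right_injective (V → ℝ) (inv_ne_zero h0y.ne') hu)
  · rintro ⟨y, hy⟩
    have hy1 : ‖y‖ = 1 := by simpa using hy
    obtain ⟨F, hF, c, hc0, hcF, hcy⟩ := h.exists_coeff y
    have hs : 0 < ∑ v, c v := by
      refine lt_of_le_of_ne (Finset.sum_nonneg fun v _ => hc0 v) fun he => ?_
      have hz : ∀ v, c v = 0 := fun v =>
        (Finset.sum_eq_zero_iff_of_nonneg fun v _ => hc0 v).1 he.symm v (Finset.mem_univ v)
      simp only [hz, zero_smul, Finset.sum_const_zero] at hcy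
      rw [← hcy] at hy1
      simp at hy1
    refine ⟨⟨(∑ v, c v)⁻¹ • c, mem_realization_generatedBy.2
      ⟨fun v => mul_nonneg (inv_nonneg.2 hs.le) (hc0 v), ?_, F, hF, fun v hv => by
        simp [hcF v hv]⟩⟩, Subtype.ext ?_⟩
    · simp only [Pi.smul_apply, smul_eq_mul]
      rw [← Finset.mul_sum, inv_mul_cancel₀ hs.ne']
    · have e : ∑ v, ((∑ v, c v)⁻¹ • c) v • p v = (∑ v, c v)⁻¹ • y := by
        simp only [Pi.smul_apply, smul_eq_mul, mul_smul]
        rw [← Finset.smul_sum, hcy]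
      simp only [toSphere, e, norm_smul, norm_inv, hy1, mul_one, inv_inv]
      rw [Real.norm_of_nonneg hs.le, smul_smul, mul_inv_cancel₀ hs.ne', one_smul]

/-- The radial projection is a homeomorphism. -/
noncomputable def homeomorphSphere [FiniteDimensional ℝ E] (h : IsPolytopal 𝓕 p) :
    realization (generatedBy 𝓕) ≃ₜ Metric.sphere (0 : E) 1 :=
  Continuous.homeoOfEquivCompactToT2 (f := Equiv.ofBijective _ h.toSphere_bijective)
    h.continuous_toSphere

/-- A symmetry of the labels that negates the vertices becomes the antipodal map of the sphere. -/
theorem toSphere_comp [FiniteDimensional ℝ E] (h : IsPolytopal 𝓕 p) {σ : V → V}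
    (hσ : Involutive σ) (hp : ∀ v, p (σ v) = -p v) {x y : realization (generatedBy 𝓕)}
    (hxy : y.1 = x.1 ∘ σ) : h.toSphere y = -h.toSphere x := by
  have hs : ∑ v, y.1 v • p v = -∑ v, x.1 v • p v := by
    rw [hxy, ← Equiv.sum_comp hσ.toPerm, ← Finset.sum_neg_distrib]
    exact Finset.sum_congr rfl fun v _ => by simp [hσ v, hp]
  exact Subtype.ext (by simp [toSphere, hs])

end IsPolytopal
end Polytopal

/-! ### The action of the permutations on labels, and orbits of sets of labels -/

section Orbits

open Equiv

theorem mem_permLabel {g : Perm (Fin 6)} {S : Label} {i : Fin 6} :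
    g i ∈ permLabel g S ↔ i ∈ S := by
  simp [permLabel]

theorem permLabel_injective (g : Perm (Fin 6)) : Injective (permLabel g) :=
  Finset.map_injective _

@[simp] theorem permLabel_one (S : Label) : permLabel 1 S = S := by
  exact Finset.map_refl

theorem permLabel_mul (g h : Perm (Fin 6)) (S : Label) :
    permLabel (g * h) S = permLabel g (permLabel h S) := by
  simp only [permLabel, Finset.map_map]
  rfl

@[simp] theorem card_permLabel (g : Perm (Fin 6)) (S : Label) :
    (permLabel g S).card = S.card := Finset.card_map _

@[simp] theorem permLabel_singleton (g : Perm (Fin 6)) (i : Fin 6) :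
    permLabel g {i} = {g i} := by simp [permLabel]

@[simp] theorem permLabel_insert (g : Perm (Fin 6)) (i : Fin 6) (S : Label) :
    permLabel g (insert i S) = insert (g i) (permLabel g S) := by simp [permLabel]

@[simp] theorem permLabel_compl (g : Perm (Fin 6)) (S : Label) :
    permLabel g Sᶜ = (permLabel g S)ᶜ := by
  ext i
  obtain ⟨i, rfl⟩ := g.surjective i
  simp only [Finset.mem_compl, mem_permLabel]

/-- The action of a permutation on sets of labels. -/
def relabel (g : Perm (Fin 6)) (s : Finset Label) : Finset Label := s.image (permLabel g)

@[simp] theorem relabel_one (s : Finset Label) : relabel 1 s = s := by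
  ext; simp [relabel]

theorem relabel_mul (g h : Perm (Fin 6)) (s : Finset Label) :
    relabel (g * h) s = relabel g (relabel h s) := by
  simp only [relabel, Finset.image_image]
  exact Finset.image_congr fun S _ => permLabel_mul g h S

@[simp] theorem relabel_inv_relabel (g : Perm (Fin 6)) (s : Finset Label) :
    relabel g⁻¹ (relabel g s) = s := by
  rw [← relabel_mul, inv_mul_cancel, relabel_one]

@[simp] theorem relabel_relabel_inv (g : Perm (Fin 6)) (s : Finset Label) :
    relabel g (relabel g⁻¹ s) = s := by
  rw [← relabel_mul, mul_inv_cancel, relabel_one]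

theorem relabel_injective (g : Perm (Fin 6)) : Injective (relabel g) :=
  Finset.image_injective (permLabel_injective g)

@[simp] theorem card_relabel (g : Perm (Fin 6)) (s : Finset Label) :
    (relabel g s).card = s.card := Finset.card_image_of_injective _ (permLabel_injective g)

@[simp] theorem relabel_subset_relabel {g : Perm (Fin 6)} {s t : Finset Label} :
    relabel g s ⊆ relabel g t ↔ s ⊆ t := Finset.image_subset_image_iff (permLabel_injective g)

theorem relabel_mono {g : Perm (Fin 6)} {s t : Finset Label} (h : s ⊆ t) :
    relabel g s ⊆ relabel g t := relabel_subset_relabel.2 h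

theorem permLabel_mem_relabel {g : Perm (Fin 6)} {S : Label} {s : Finset Label} :
    permLabel g S ∈ relabel g s ↔ S ∈ s := (permLabel_injective g).mem_finset_image

theorem exists_permLabel_eq (g : Perm (Fin 6)) (S : Label) : ∃ T, permLabel g T = S :=
  ⟨permLabel g⁻¹ S, by rw [← permLabel_mul, mul_inv_cancel, permLabel_one]⟩

theorem relabel_erase (g : Perm (Fin 6)) (s : Finset Label) (S : Label) :
    relabel g (s.erase S) = (relabel g s).erase (permLabel g S) :=
  Finset.image_erase (permLabel_injective g) s S

theorem relabel_union (g : Perm (Fin 6)) (s t : Finset Label) :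
    relabel g (s ∪ t) = relabel g s ∪ relabel g t := Finset.image_union s t

@[simp] theorem relabel_insert (g : Perm (Fin 6)) (S : Label) (s : Finset Label) :
    relabel g (insert S s) = insert (permLabel g S) (relabel g s) := Finset.image_insert _ _ _

@[simp] theorem relabel_singleton (g : Perm (Fin 6)) (S : Label) :
    relabel g {S} = {permLabel g S} := Finset.image_singleton _ _

/-- The union of the orbits of the members of `R`. -/
def orbits (R : Set (Finset Label)) : Set (Finset Label) := {s | ∃ g, ∃ r ∈ R, s = relabel g r}

theorem subset_orbits (R : Set (Finset Label)) : R ⊆ orbits R := fun r hr => ⟨1, r, hr, by simp⟩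

theorem relabel_mem_orbits {R : Set (Finset Label)} {s : Finset Label} (g : Perm (Fin 6))
    (hs : s ∈ orbits R) : relabel g s ∈ orbits R := by
  obtain ⟨h, r, hr, rfl⟩ := hs
  exact ⟨g * h, r, hr, (relabel_mul g h r).symm⟩

theorem orbits_union (R R' : Set (Finset Label)) : orbits (R ∪ R') = orbits R ∪ orbits R' := by
  ext s
  constructor
  · rintro ⟨g, r, hr | hr, rfl⟩
    · exact Or.inl ⟨g, r, hr, rfl⟩
    · exact Or.inr ⟨g, r, hr, rfl⟩
  · rintro (⟨g, r, hr, rfl⟩ | ⟨g, r, hr, rfl⟩)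
    · exact ⟨g, r, Or.inl hr, rfl⟩
    · exact ⟨g, r, Or.inr hr, rfl⟩

/-- `S_6` is transitive on tuples of distinct indices. This is why each family of facets given by
distinct letters is a single orbit. -/
theorem exists_perm_extending {n : ℕ} (hn : n ≤ 6) (f : Fin n → Fin 6)
    (hf : (List.ofFn f).Nodup) : ∃ g : Perm (Fin 6), ∀ a, g (Fin.castLE hn a) = f a :=
  Perm.exists_extending_pair _ f (Fin.castLE_injective hn) (List.nodup_ofFn.1 hf)

theorem exists_perm_extending_two {i j : Fin 6} (h : i ≠ j) :
    ∃ g : Perm (Fin 6), g 0 = i ∧ g 1 = j := by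
  obtain ⟨g, hg⟩ := exists_perm_extending (by decide) ![i, j] (by simpa using h)
  exact ⟨g, hg 0, hg 1⟩

theorem exists_perm_extending_three {i j k : Fin 6} (h : [i, j, k].Nodup) :
    ∃ g : Perm (Fin 6), g 0 = i ∧ g 1 = j ∧ g 2 = k := by
  obtain ⟨g, hg⟩ := exists_perm_extending (by decide) ![i, j, k] (by simpa using h)
  exact ⟨g, hg 0, hg 1, hg 2⟩

theorem exists_perm_extending_five {i j k l m : Fin 6} (h : [i, j, k, l, m].Nodup) :
    ∃ g : Perm (Fin 6), g 0 = i ∧ g 1 = j ∧ g 2 = k ∧ g 3 = l ∧ g 4 = m := by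
  obtain ⟨g, hg⟩ := exists_perm_extending (by decide) ![i, j, k, l, m] (by simpa using h)
  exact ⟨g, hg 0, hg 1, hg 2, hg 3, hg 4⟩

theorem exists_perm_extending_six {i j k l m n : Fin 6} (h : [i, j, k, l, m, n].Nodup) :
    ∃ g : Perm (Fin 6), g 0 = i ∧ g 1 = j ∧ g 2 = k ∧ g 3 = l ∧ g 4 = m ∧ g 5 = n := by
  obtain ⟨g, hg⟩ := exists_perm_extending (by decide) ![i, j, k, l, m, n] (by simpa using h)
  exact ⟨g, hg 0, hg 1, hg 2, hg 3, hg 4, hg 5⟩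

theorem nodup_map (g : Perm (Fin 6)) {l : List (Fin 6)} (h : l.Nodup) : (l.map g).Nodup :=
  h.map g.injective

end Orbits

/-! ### The complexes as complexes generated by orbits -/

/-- A facet of `X6`. -/
def rep6 : Finset Label := {{0}, {1}, {2}, {3}, {4}}

/-- A facet of `X12`. -/
def rep12 : Finset Label := {{0}, {1}, {2}, {3}, {4}ᶜ}

/-- A facet of `X32` at an edge of a tetrahedron. -/
def repEdge : Finset Label := {{0}, {1}, {0, 1, 2}, {0, 1, 3}, {4}ᶜ}

/-- A facet of `X32` at a vertex of a tetrahedron. -/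
def repVertex : Finset Label := {{0}, {0, 1, 2}, {0, 1, 3}, {0, 2, 3}, {4}ᶜ}

/-- A facet of `X32` in the middle of a tetrahedron. -/
def repMiddle : Finset Label := {{0, 1, 2}, {0, 1, 3}, {0, 2, 3}, {1, 2, 3}, {4}ᶜ}

/-- A new facet after the first round of flips that is removed in the second round. -/
def repNew : Finset Label := {{0}, {1}, {0, 1, 2}, {0, 1, 3}, {0, 1, 5}}

/-- A facet of `S432` of the first type. -/
def repStar : Finset Label := {{0}, {0, 1, 2}, {0, 1, 3}, {0, 1, 4}, {0, 1, 5}}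

/-- A facet of `S432` of the third type. -/
def repFlipped : Finset Label := {{0}, {4}ᶜ, {0, 1, 2}, {0, 1, 3}, {0, 1, 5}}

theorem X6_eq : X6 = generatedBy (orbits {rep6}) := by
  unfold X6
  congr 1
  ext s
  constructor
  · rintro ⟨i, rfl⟩
    -- The representative omits the index 5, and the transposition makes it omit `i`.
    refine ⟨Equiv.swap 5 i, rep6, rfl, ?_⟩
    revert i
    decide +kernel
  · rintro ⟨g, r, rfl, rfl⟩
    refine ⟨g 5, ?_⟩
    have : rep6 = (Finset.univ.erase 5).image fun j => {j} := by decide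
    rw [this, relabel, Finset.image_image]
    ext S
    simp only [Finset.mem_image, Finset.mem_erase, Finset.mem_univ, and_true, comp_apply,
      permLabel_singleton]
    constructor
    · rintro ⟨a, ha, rfl⟩
      exact ⟨g a, g.injective.ne ha, rfl⟩
    · rintro ⟨a, ha, rfl⟩
      obtain ⟨a, rfl⟩ := g.surjective a
      exact ⟨a, fun h => ha (by rw [h]), rfl⟩

theorem X12_eq : X12 = generatedBy (orbits {rep12}) := by
  unfold X12
  congr 1
  ext s
  constructor
  · rintro ⟨i, j, k, l, m, h, rfl⟩
    obtain ⟨g, rfl, rfl, rfl, rfl, rfl⟩ := exists_perm_extending_five h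
    exact ⟨g, _, rfl, by simp [rep12]⟩
  · rintro ⟨g, r, rfl, rfl⟩
    exact ⟨g 0, g 1, g 2, g 3, g 4, nodup_map g (l := [0, 1, 2, 3, 4]) (by decide), by simp [rep12]⟩

theorem X32_eq : X32 = generatedBy (orbits {repEdge, repVertex, repMiddle}) := by
  unfold X32
  rw [Set.insert_eq, Set.insert_eq, ← Set.union_assoc, orbits_union, orbits_union]
  congr 1
  congr 1
  · congr 1 <;> ext s <;> constructor
    · rintro ⟨i, j, k, l, m, h, rfl⟩
      obtain ⟨g, rfl, rfl, rfl, rfl, rfl⟩ := exists_perm_extending_five h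
      exact ⟨g, _, rfl, by simp [repEdge]⟩
    · rintro ⟨g, r, rfl, rfl⟩
      exact ⟨g 0, g 1, g 2, g 3, g 4, nodup_map g (l := [0, 1, 2, 3, 4]) (by decide),
        by simp [repEdge]⟩
    · rintro ⟨i, j, k, l, m, h, rfl⟩
      obtain ⟨g, rfl, rfl, rfl, rfl, rfl⟩ := exists_perm_extending_five h
      exact ⟨g, _, rfl, by simp [repVertex]⟩
    · rintro ⟨g, r, rfl, rfl⟩
      exact ⟨g 0, g 1, g 2, g 3, g 4, nodup_map g (l := [0, 1, 2, 3, 4]) (by decide),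
        by simp [repVertex]⟩
  · ext s
    constructor
    · rintro ⟨i, j, k, l, m, h, rfl⟩
      obtain ⟨g, rfl, rfl, rfl, rfl, rfl⟩ := exists_perm_extending_five h
      exact ⟨g, _, rfl, by simp [repMiddle]⟩
    · rintro ⟨g, r, rfl, rfl⟩
      exact ⟨g 0, g 1, g 2, g 3, g 4, nodup_map g (l := [0, 1, 2, 3, 4]) (by decide),
        by simp [repMiddle]⟩

theorem facetType1_eq : facetType1 = orbits {repStar} := by
  ext s
  constructor
  · rintro ⟨i, j, k, l, m, n, h, rfl⟩
    obtain ⟨g, rfl, rfl, rfl, rfl, rfl, rfl⟩ := exists_perm_extending_six h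
    exact ⟨g, _, rfl, by simp [repStar]⟩
  · rintro ⟨g, r, rfl, rfl⟩
    exact ⟨g 0, g 1, g 2, g 3, g 4, g 5, nodup_map g (l := [0, 1, 2, 3, 4, 5]) (by decide),
      by simp [repStar]⟩

theorem facetType2_eq : facetType2 = orbits {repMiddle} := by
  ext s
  constructor
  · rintro ⟨i, j, k, l, m, h, rfl⟩
    obtain ⟨g, rfl, rfl, rfl, rfl, rfl⟩ := exists_perm_extending_five h
    refine ⟨g, _, rfl, ?_⟩
    ext
    simp [repMiddle]
    tauto
  · rintro ⟨g, r, rfl, rfl⟩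
    refine ⟨g 0, g 1, g 2, g 3, g 4, nodup_map g (l := [0, 1, 2, 3, 4]) (by decide), ?_⟩
    ext
    simp [repMiddle]
    tauto

theorem facetType3_eq : facetType3 = orbits {repFlipped} := by
  ext s
  constructor
  · rintro ⟨i, j, m, k, l, n, h, rfl⟩
    -- In `repFlipped` the index of the complement is 4, so it is moved to the fifth place.
    replace h : [i, j, k, l, m, n].Nodup := by
      simp only [List.nodup_cons, List.mem_cons, List.not_mem_nil] at h ⊢
      grind
    obtain ⟨g, rfl, rfl, rfl, rfl, rfl, rfl⟩ := exists_perm_extending_six h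
    exact ⟨g, _, rfl, by simp [repFlipped]⟩
  · rintro ⟨g, r, rfl, rfl⟩
    exact ⟨g 0, g 1, g 4, g 2, g 3, g 5, nodup_map g (l := [0, 1, 4, 2, 3, 5]) (by decide),
      by simp [repFlipped]⟩

theorem facetType4_eq : facetType4 = orbits {repVertex} := by
  ext s
  constructor
  · rintro ⟨i, j, k, l, m, h, rfl⟩
    obtain ⟨g, rfl, rfl, rfl, rfl, rfl⟩ := exists_perm_extending_five h
    refine ⟨g, _, rfl, ?_⟩
    ext
    simp [repVertex]
    tauto
  · rintro ⟨g, r, rfl, rfl⟩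
    refine ⟨g 0, g 1, g 2, g 3, g 4, nodup_map g (l := [0, 1, 2, 3, 4]) (by decide), ?_⟩
    ext
    simp [repVertex]
    tauto

theorem S432_eq : S432 = generatedBy (orbits {repStar, repMiddle, repFlipped, repVertex}) := by
  unfold S432
  rw [facetType1_eq, facetType2_eq, facetType3_eq, facetType4_eq, Set.insert_eq, Set.insert_eq,
    Set.insert_eq, ← Set.union_assoc, ← Set.union_assoc, orbits_union, orbits_union, orbits_union]

/-! ### The complexes are boundary complexes of simplicial polytopes -/

section Certificates

/-- The quotient of `ℝ⁶` by the diagonal, in coordinates. -/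
noncomputable def modDiagonal : (Fin 6 → ℝ) →ₗ[ℝ] EuclideanSpace ℝ (Fin 5) where
  toFun x := WithLp.toLp 2 fun i => x i.castSucc - x (Fin.last 5)
  map_add' x y := by
    ext i
    simp only [Pi.add_apply, PiLp.add_apply]
    ring
  map_smul' c x := by
    ext i
    simp only [Pi.smul_apply, PiLp.smul_apply, smul_eq_mul, RingHom.id_apply]
    ring

theorem modDiagonal_apply (x : Fin 6 → ℝ) (i : Fin 5) :
    modDiagonal x i = x i.castSucc - x (Fin.last 5) := rfl

theorem modDiagonal_one : modDiagonal 1 = 0 := by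
  ext i
  simp [modDiagonal_apply]

/-- The kernel of `modDiagonal` is exactly the diagonal. -/
theorem exists_eq_add_of_modDiagonal_eq {x y : Fin 6 → ℝ} (h : modDiagonal x = modDiagonal y) :
    ∃ c : ℝ, ∀ i, x i = y i + c := by
  refine ⟨x (Fin.last 5) - y (Fin.last 5), fun i => ?_⟩
  induction i using Fin.lastCases with
  | last => ring
  | cast i =>
    have := congrArg (fun z : EuclideanSpace ℝ (Fin 5) => z i) h
    simp only [modDiagonal_apply] at this
    linarith

/-- The linear functional on the quotient by the diagonal given by coefficients with sum zero. -/
noncomputable def functional (a : Fin 6 → ℝ) : EuclideanSpace ℝ (Fin 5) →ₗ[ℝ] ℝ where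
  toFun y := ∑ i : Fin 5, a i.castSucc * y i
  map_add' x y := by simp [mul_add, Finset.sum_add_distrib]
  map_smul' c x := by simp [Finset.mul_sum, mul_left_comm]

/-- Coefficients with sum zero vanish on the diagonal, so the functional descends to the quotient.
Its values on labels become integer sums over subsets, which can be evaluated. -/
theorem functional_modDiagonal {a : Fin 6 → ℝ} (ha : ∑ i, a i = 0) (x : Fin 6 → ℝ) :
    functional a (modDiagonal x) = ∑ i, a i * x i := by
  simp only [functional, LinearMap.coe_mk, AddHom.coe_mk, modDiagonal_apply]
  rw [Fin.sum_univ_castSucc] at ha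
  rw [Fin.sum_univ_castSucc fun i => a i * x i]
  simp only [mul_sub, Finset.sum_sub_distrib, ← Finset.sum_mul]
  rw [eq_neg_of_add_eq_zero_left ha]
  ring

/-- The indicator function of a label. -/
def indicator (S : Label) (i : Fin 6) : ℝ := if i ∈ S then 1 else 0

/-- The indicator function of a label modulo the diagonal, rescaled by a weight that depends on the
cardinality of the label. -/
noncomputable def weightedPoint (w : ℕ → ℤ) (S : Label) : EuclideanSpace ℝ (Fin 5) :=
  (w S.card : ℝ) • modDiagonal (indicator S)

theorem functional_weightedPoint {a : Fin 6 → ℝ} (ha : ∑ i, a i = 0) (w : ℕ → ℤ) (S : Label) :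
    functional a (weightedPoint w S) = w S.card * ∑ i ∈ S, a i := by
  rw [weightedPoint, map_smul, functional_modDiagonal ha, smul_eq_mul]
  congr 1
  simp [indicator]

/-- A criterion, to be checked on representatives only, for the orbits of `R` to be the facets of a
simplicial polytope. -/
theorem isPolytopal_orbits {R : Set (Finset Label)} {w : ℕ → ℤ}
    (hsupport : ∀ r ∈ R, ∃ a : Fin 6 → ℤ, ∃ D : ℤ, 0 < D ∧ ∑ i, a i = 0 ∧ ∀ S : Label,
      w S.card * ∑ i ∈ S, a i ≤ D ∧ (w S.card * ∑ i ∈ S, a i = D ↔ S ∈ r))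
    (hneighbor : ∀ r ∈ R, ∀ S ∈ r, ∃ i j : Fin 6, ∃ r' ∈ R,
      r.erase S ⊆ relabel (Equiv.swap i j) r' ∧ S ∉ relabel (Equiv.swap i j) r')
    (hcard : ∀ r ∈ R, r.card = 5) (hne : R.Nonempty) :
    IsPolytopal (orbits R) (weightedPoint w) where
  support := by
    rintro _ ⟨g, r, hr, rfl⟩
    obtain ⟨a, D, hD, ha, h⟩ := hsupport r hr
    have hD' : (0 : ℝ) < D := by exact_mod_cast hD
    -- The functional of the representative is transported along `g` and normalised to the value 1
    -- on the facet.
    refine ⟨(D : ℝ)⁻¹ • functional fun i => a (g⁻¹ i), fun S => ?_⟩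
    have ha' : ∑ i, (a (g⁻¹ i) : ℝ) = 0 := by
      rw [Equiv.sum_comp g⁻¹ fun i => (a i : ℝ)]
      exact_mod_cast ha
    obtain ⟨T, rfl⟩ := exists_permLabel_eq g S
    rw [LinearMap.smul_apply, functional_weightedPoint ha', card_permLabel, smul_eq_mul]
    have hs : ∑ i ∈ permLabel g T, (a (g⁻¹ i) : ℝ) = ((∑ i ∈ T, a i : ℤ) : ℝ) := by
      simp [permLabel]
    rw [hs, permLabel_mem_relabel, ← (h T).2, inv_mul_le_iff₀ hD', mul_one,
      inv_mul_eq_one₀ hD'.ne']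
    refine ⟨by exact_mod_cast (h T).1, ?_⟩
    rw [eq_comm]
    exact_mod_cast Iff.rfl
  neighbor := by
    rintro _ ⟨g, r, hr, rfl⟩ S hS
    obtain ⟨T, rfl⟩ := exists_permLabel_eq g S
    -- All neighbours of representatives are obtained from representatives by at most one
    -- transposition, which keeps the search small.
    obtain ⟨i, j, r', hr', h1, h2⟩ := hneighbor r hr T (permLabel_mem_relabel.1 hS)
    refine ⟨_, ⟨g * Equiv.swap i j, r', hr', rfl⟩, ?_, ?_⟩
    · rw [relabel_mul, ← relabel_erase]
      exact relabel_mono h1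
    · rw [relabel_mul, permLabel_mem_relabel]
      exact h2
  card_eq := by
    rintro _ ⟨g, r, hr, rfl⟩
    rw [card_relabel, hcard r hr, finrank_euclideanSpace, Fintype.card_fin]
  nonempty := hne.mono (subset_orbits R)

/-- Weights of the labels according to their cardinality. -/
def weight (a b c n : ℕ) : ℤ := if n = 1 then a else if n = 3 then b else if n = 5 then c else 0

/-- In this and the next three certificates the coefficients are determined up to scale: their sum
is zero and the five weighted values on the representative coincide, the common value being `D`.
Labels that are not vertices get weight 0, hence the value 0, which is below `D`. -/
theorem isPolytopal_X6 : IsPolytopal (orbits {rep6}) (weightedPoint (weight 1 0 0)) := by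
  refine isPolytopal_orbits ?_ ?_ ?_ ⟨_, rfl⟩
  · simp only [Set.mem_singleton_iff, forall_eq]
    exact ⟨![1, 1, 1, 1, 1, -5], 1, by decide, by decide, by decide +kernel⟩
  · simp only [Set.mem_singleton_iff, forall_eq, exists_eq_left]
    decide +kernel
  · simp only [Set.mem_singleton_iff, forall_eq]
    decide +kernel

/-- As multiples of the actual points the factors are 9 and 10: the barycentres of the facets are
pushed slightly outwards, as in a stellar subdivision. -/
theorem isPolytopal_X12 : IsPolytopal (orbits {rep12}) (weightedPoint (weight 9 0 2)) := by
  refine isPolytopal_orbits ?_ ?_ ?_ ⟨_, rfl⟩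
  · simp only [Set.mem_singleton_iff, forall_eq]
    exact ⟨![2, 2, 2, 2, -9, 1], 18, by decide, by decide, by decide +kernel⟩
  · simp only [Set.mem_singleton_iff, forall_eq, exists_eq_left]
    decide +kernel
  · simp only [Set.mem_singleton_iff, forall_eq]
    decide +kernel

/-- The factors on the points are 5, 6 and 10 for labels with 1, 3 and 5 elements. The functionals
belong to the edge, vertex and middle tetrahedra in this order. -/
theorem isPolytopal_X32 :
    IsPolytopal (orbits {repEdge, repVertex, repMiddle}) (weightedPoint (weight 5 2 2)) := by
  refine isPolytopal_orbits ?_ ?_ ?_ ⟨_, Or.inl rfl⟩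
  · simp only [Set.mem_insert_iff, Set.mem_singleton_iff, forall_eq_or_imp, forall_eq]
    exact ⟨⟨![2, 2, 1, 1, -5, -1], 10, by decide, by decide, by decide +kernel⟩,
      ⟨![4, 3, 3, 3, -10, -3], 20, by decide, by decide, by decide +kernel⟩,
      ⟨![1, 1, 1, 1, -3, -1], 6, by decide, by decide, by decide +kernel⟩⟩
  · simp only [Set.mem_insert_iff, Set.mem_singleton_iff, forall_eq_or_imp, forall_eq,
      exists_eq_or_imp, exists_eq_left]
    refine ⟨?_, ?_, ?_⟩ <;> decide +kernel
  · simp only [Set.mem_insert_iff, Set.mem_singleton_iff, forall_eq_or_imp, forall_eq]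
    decide +kernel

/-- Labels with 1 and 5 elements have equal weights, so that the polytope is centrally symmetric. -/
theorem isPolytopal_S432 :
    IsPolytopal (orbits {repStar, repMiddle, repFlipped, repVertex})
      (weightedPoint (weight 4 3 4)) := by
  refine isPolytopal_orbits ?_ ?_ ?_ ⟨_, Or.inl rfl⟩
  · simp only [Set.mem_insert_iff, Set.mem_singleton_iff, forall_eq_or_imp, forall_eq]
    exact ⟨⟨![9, 7, -4, -4, -4, -4], 36, by decide, by decide, by decide +kernel⟩,
      ⟨![4, 4, 4, 4, -9, -7], 36, by decide, by decide, by decide +kernel⟩,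
      ⟨![6, 3, -1, -1, -6, -1], 24, by decide, by decide, by decide +kernel⟩,
      ⟨![6, 1, 1, 1, -6, -3], 24, by decide, by decide, by decide +kernel⟩⟩
  · simp only [Set.mem_insert_iff, Set.mem_singleton_iff, forall_eq_or_imp, forall_eq,
      exists_eq_or_imp, exists_eq_left]
    refine ⟨?_, ?_, ?_, ?_⟩ <;> decide +kernel
  · simp only [Set.mem_insert_iff, Set.mem_singleton_iff, forall_eq_or_imp, forall_eq]
    decide +kernel

end Certificates

/-! ### Geometric simplicial complexes with underlying space the boundary of the simplex -/

section Geometric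

theorem mem_convexHull_image_iff {V E : Type*} [Fintype V] [AddCommGroup E] [Module ℝ E] {p : V → E}
    {s : Finset V} {x : E} : x ∈ convexHull ℝ (p '' s) ↔
      ∃ c : V → ℝ, (∀ v, 0 ≤ c v) ∧ (∀ v, v ∉ s → c v = 0) ∧ ∑ v, c v = 1 ∧ ∑ v, c v • p v = x := by
  classical
  constructor
  · intro hx
    refine convexHull_min (t := {x | ∃ c : V → ℝ, (∀ v, 0 ≤ c v) ∧ (∀ v, v ∉ s → c v = 0) ∧
      ∑ v, c v = 1 ∧ ∑ v, c v • p v = x}) ?_ ?_ hx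
    · rintro _ ⟨v, hv, rfl⟩
      refine ⟨Pi.single v 1, fun u => ?_, fun u hu => ?_, by simp, ?_⟩
      · by_cases h : u = v
        · subst h; simp
        · simp [h]
      · rw [Pi.single_eq_of_ne]
        rintro rfl
        exact hu hv
      · simp [Pi.single_apply]
    · rintro _ ⟨c, hc0, hcs, hc1, rfl⟩ _ ⟨d, hd0, hds, hd1, rfl⟩ a b ha hb hab
      refine ⟨a • c + b • d, fun v => ?_, fun v hv => by simp [hcs v hv, hds v hv], ?_, ?_⟩
      · exact add_nonneg (mul_nonneg ha (hc0 v)) (mul_nonneg hb (hd0 v))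
      · simp [Finset.sum_add_distrib, ← Finset.mul_sum, hc1, hd1, hab]
      · simp [Finset.sum_add_distrib, add_smul, mul_smul, ← Finset.smul_sum]
  · rintro ⟨c, hc0, hcs, hc1, rfl⟩
    have h1 := Finset.sum_subset (Finset.subset_univ s) fun v _ hv => hcs v hv
    have h2 := Finset.sum_subset (f := fun v => c v • p v) (Finset.subset_univ s) fun v _ hv => by
      rw [hcs v hv, zero_smul]
    rw [← h2]
    exact (convex_convexHull ℝ _).sum_mem (fun v _ => hc0 v) (h1.trans hc1) fun v hv =>
      subset_convexHull ℝ _ ⟨v, hv, rfl⟩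

theorem point_apply (S : Label) (i : Fin 6) : point S i = (S.card : ℝ)⁻¹ * indicator S i := by
  simp [point, indicator, Pi.single_apply]

theorem point_eq (S : Label) : point S = (S.card : ℝ)⁻¹ • indicator S := funext (point_apply S)

theorem point_nonneg (S : Label) (i : Fin 6) : 0 ≤ point S i := by
  rw [point_apply, indicator]
  positivity

theorem point_eq_zero {S : Label} {i : Fin 6} (h : i ∉ S) : point S i = 0 := by
  rw [point_apply, indicator, if_neg h, mul_zero]

theorem sum_point {S : Label} (h : 0 < S.card) : ∑ i, point S i = 1 := by
  simp only [point_apply, ← Finset.mul_sum, indicator]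
  rw [Finset.sum_boole, Finset.filter_univ_mem]
  exact inv_mul_cancel₀ (by exact_mod_cast h.ne')

variable {𝓕 : Set (Finset Label)} {w : ℕ → ℤ}

/-- The factor by which the weighted point of a label is larger than its point. -/
def factor (w : ℕ → ℤ) (S : Label) : ℝ := w S.card * S.card

theorem weightedPoint_eq {S : Label} (hS : 0 < S.card) :
    weightedPoint w S = factor w S • modDiagonal (point S) := by
  rw [weightedPoint, factor, point_eq, map_smul, smul_smul, mul_assoc, mul_inv_cancel₀, mul_one]
  exact_mod_cast hS.ne'

theorem factor_pos {S : Label} (hS : 0 < S.card ∧ 0 < w S.card) : 0 < factor w S := by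
  have h1 : (0 : ℝ) < S.card := by exact_mod_cast hS.1
  have h2 : (0 : ℝ) < w S.card := by exact_mod_cast hS.2
  exact mul_pos h2 h1

/-- Passing between the points in `ℝ⁶` and the vertices of the polytope only rescales coefficients
by positive factors. This transfers independence and uniqueness of nonnegative coefficients to the
points. -/
theorem modDiagonal_sum_point (hw : ∀ F ∈ 𝓕, ∀ S ∈ F, 0 < S.card ∧ 0 < w S.card) {F : Finset Label}
    (hF : F ∈ 𝓕) {c : Label → ℝ} (hc : ∀ S, S ∉ F → c S = 0) :
    modDiagonal (∑ S, c S • point S) = ∑ S, (c S * (factor w S)⁻¹) • weightedPoint w S := by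
  rw [map_sum]
  refine Finset.sum_congr rfl fun S _ => ?_
  by_cases hS : S ∈ F
  · have := hw F hF S hS
    rw [weightedPoint_eq this.1, smul_smul, mul_assoc, inv_mul_cancel₀ (factor_pos this).ne',
      mul_one, map_smul]
  · rw [hc S hS, zero_smul, zero_mul, zero_smul, map_zero]

theorem eq_zero_of_sum_points_eq_zero (h : IsPolytopal 𝓕 (weightedPoint w))
    (hw : ∀ F ∈ 𝓕, ∀ S ∈ F, 0 < S.card ∧ 0 < w S.card) {F : Finset Label} (hF : F ∈ 𝓕)
    {c : Label → ℝ} (hc : ∀ S, S ∉ F → c S = 0) (h0 : ∑ S, c S • point S = 0) : c = 0 := by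
  have := h.eq_zero_of_sum_eq_zero hF (c := fun S => c S * (factor w S)⁻¹)
    (fun S hS => by simp [hc S hS]) (by rw [← modDiagonal_sum_point hw hF hc, h0, map_zero])
  funext S
  by_cases hS : S ∈ F
  · simpa [(factor_pos (hw F hF S hS)).ne'] using congrFun this S
  · exact hc S hS

theorem coeff_unique_points (h : IsPolytopal 𝓕 (weightedPoint w))
    (hw : ∀ F ∈ 𝓕, ∀ S ∈ F, 0 < S.card ∧ 0 < w S.card) {F G : Finset Label} (hF : F ∈ 𝓕)
    (hG : G ∈ 𝓕) {c d : Label → ℝ} (hc0 : ∀ S, 0 ≤ c S) (hd0 : ∀ S, 0 ≤ d S)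
    (hc : ∀ S, S ∉ F → c S = 0) (hd : ∀ S, S ∉ G → d S = 0)
    (hcd : ∑ S, c S • point S = ∑ S, d S • point S) : c = d := by
  have hpos : ∀ {F : Finset Label} (_ : F ∈ 𝓕) {c : Label → ℝ} (_ : ∀ S, 0 ≤ c S)
      (_ : ∀ S, S ∉ F → c S = 0) (S : Label), 0 ≤ c S * (factor w S)⁻¹ := by
    intro F hF c hc0 hc S
    by_cases hS : S ∈ F
    · exact mul_nonneg (hc0 S) (inv_nonneg.2 (factor_pos (hw F hF S hS)).le)
    · rw [hc S hS, zero_mul]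
  have key := h.coeff_unique hF hG (c := fun S => c S * (factor w S)⁻¹)
    (d := fun S => d S * (factor w S)⁻¹) (hpos hF hc0 hc) (hpos hG hd0 hd)
    (fun S hS => by simp [hc S hS]) (fun S hS => by simp [hd S hS])
    (by rw [← modDiagonal_sum_point hw hF hc, ← modDiagonal_sum_point hw hG hd, hcd])
  funext S
  by_cases hS : 0 < S.card ∧ 0 < w S.card
  · exact mul_right_cancel₀ (inv_ne_zero (factor_pos hS).ne') (congrFun key S)
  · rw [hc S fun hSF => hS (hw F hF S hSF), hd S fun hSG => hS (hw G hG S hSG)]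

theorem sum_points_mem_boundarySimplex (hw : ∀ F ∈ 𝓕, ∀ S ∈ F, 0 < S.card ∧ 0 < w S.card)
    (hm : ∀ F ∈ 𝓕, ∃ m, ∀ S ∈ F, m ∉ S) {F : Finset Label} (hF : F ∈ 𝓕) {c : Label → ℝ}
    (hc0 : ∀ S, 0 ≤ c S) (hc : ∀ S, S ∉ F → c S = 0) (hc1 : ∑ S, c S = 1) :
    ∑ S, c S • point S ∈ boundarySimplex := by
  obtain ⟨m, hm⟩ := hm F hF
  simp only [boundarySimplex, stdSimplex, Set.mem_ofPred_eq, Finset.sum_apply, Pi.smul_apply,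
    smul_eq_mul]
  refine ⟨⟨fun i => Finset.sum_nonneg fun S _ => mul_nonneg (hc0 S) (point_nonneg S i), ?_⟩, m,
    Finset.sum_eq_zero fun S _ => ?_⟩
  · rw [Finset.sum_comm, ← hc1]
    refine Finset.sum_congr rfl fun S _ => ?_
    rw [← Finset.mul_sum]
    by_cases hS : S ∈ F
    · rw [sum_point (hw F hF S hS).1, mul_one]
    · rw [hc S hS, zero_mul]
  · by_cases hS : S ∈ F
    · rw [point_eq_zero (hm S hS), mul_zero]
    · rw [hc S hS, zero_mul]

/-- Cone coordinates modulo the diagonal give a combination of points that agrees with `x` up to a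
constant vector. Each facet avoids some index, so the combination has minimal coordinate 0, as `x`
does, and the constant vanishes. -/
theorem exists_coeff_of_mem_boundarySimplex (h : IsPolytopal 𝓕 (weightedPoint w))
    (hw : ∀ F ∈ 𝓕, ∀ S ∈ F, 0 < S.card ∧ 0 < w S.card)
    (hm : ∀ F ∈ 𝓕, ∃ m, ∀ S ∈ F, m ∉ S) {x : Fin 6 → ℝ} (hx : x ∈ boundarySimplex) :
    ∃ F ∈ 𝓕, ∃ c : Label → ℝ, (∀ S, 0 ≤ c S) ∧ (∀ S, S ∉ F → c S = 0) ∧ ∑ S, c S = 1 ∧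
      ∑ S, c S • point S = x := by
  obtain ⟨F, hF, c', hc0', hc', hcx⟩ := h.exists_coeff (modDiagonal x)
  obtain ⟨c, hcdef⟩ : ∃ c : Label → ℝ, c = fun S => c' S * factor w S := ⟨_, rfl⟩
  have hc : ∀ S, S ∉ F → c S = 0 := fun S hS => by simp [hcdef, hc' S hS]
  have hc0 : ∀ S, 0 ≤ c S := fun S => by
    by_cases hS : S ∈ F
    · rw [hcdef]
      exact mul_nonneg (hc0' S) (factor_pos (hw F hF S hS)).le
    · exact (hc S hS).ge
  have hmod : modDiagonal x = modDiagonal (∑ S, c S • point S) := by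
    rw [modDiagonal_sum_point hw hF hc, ← hcx]
    refine Finset.sum_congr rfl fun S _ => ?_
    by_cases hS : S ∈ F
    · rw [hcdef, mul_assoc, mul_inv_cancel₀ (factor_pos (hw F hF S hS)).ne', mul_one]
    · rw [hc S hS, hc' S hS, zero_mul]
  obtain ⟨t, ht⟩ := exists_eq_add_of_modDiagonal_eq hmod
  obtain ⟨m, hm⟩ := hm F hF
  obtain ⟨⟨hx0, hx1⟩, k, hk⟩ := hx
  have hz0 : ∀ i, 0 ≤ (∑ S, c S • point S) i := fun i => by
    rw [Finset.sum_apply]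
    exact Finset.sum_nonneg fun S _ => mul_nonneg (hc0 S) (point_nonneg S i)
  have hzm : (∑ S, c S • point S) m = 0 := by
    rw [Finset.sum_apply]
    refine Finset.sum_eq_zero fun S _ => ?_
    by_cases hS : S ∈ F
    · rw [Pi.smul_apply, point_eq_zero (hm S hS), smul_zero]
    · rw [hc S hS, zero_smul, Pi.zero_apply]
  -- The coordinate `m` gives `t ≥ 0` and the coordinate `k` gives `t ≤ 0`.
  have ht0 : t = 0 := by
    have h1 := ht m
    have h2 := ht k
    have h3 := hx0 m
    have h4 := hz0 k
    linarith
  subst ht0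
  have hxz : ∑ S, c S • point S = x := funext fun i => by rw [ht i, add_zero]
  refine ⟨F, hF, c, hc0, hc, ?_, hxz⟩
  rw [← hx1, ← hxz]
  simp only [Finset.sum_apply, Pi.smul_apply, smul_eq_mul]
  rw [Finset.sum_comm]
  refine Finset.sum_congr rfl fun S _ => ?_
  rw [← Finset.mul_sum]
  by_cases hS : S ∈ F
  · rw [sum_point (hw F hF S hS).1, mul_one]
  · rw [hc S hS, zero_mul]

theorem mem_vertices_generatedBy {V : Type*} {𝓕 : Set (Finset V)} {v : V} :
    v ∈ vertices (generatedBy 𝓕) ↔ ∃ F ∈ 𝓕, v ∈ F := by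
  simp [vertices, generatedBy]

/-- The geometric simplicial complex spanned by points at positive multiples of the vertices of a
polytope. -/
noncomputable def geometricComplex (h : IsPolytopal 𝓕 (weightedPoint w))
    (hw : ∀ F ∈ 𝓕, ∀ S ∈ F, 0 < S.card ∧ 0 < w S.card) :
    Geometry.SimplicialComplex ℝ (Fin 6 → ℝ) where
  toPreAbstractSimplicialComplex := (generatedBy 𝓕).map point
  indep := by
    rintro _ ⟨s, ⟨-, F, hF, hsF⟩, rfl⟩
    have hli : LinearIndependent ℝ fun S : s => point S := by
      rw [Fintype.linearIndependent_iff]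
      intro g hg S
      have h0 := eq_zero_of_sum_points_eq_zero h hw hF
        (c := fun S => if hS : S ∈ s then g ⟨S, hS⟩ else 0)
        (fun S hS => dif_neg fun h => hS (hsF h)) (by
          rw [← hg, ← Finset.sum_subset (Finset.subset_univ s), ← Finset.sum_coe_sort]
          · exact Finset.sum_congr rfl fun S _ => by simp
          · intro S _ hS
            simp [hS])
      simpa using congrFun h0 S
    refine hli.affineIndependent.range.mono ?_
    rw [Finset.coe_image]
    rintro _ ⟨S, hS, rfl⟩
    exact ⟨⟨S, hS⟩, rfl⟩
  inter_subset_convexHull := by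
    rintro _ _ ⟨s, ⟨-, F, hF, hsF⟩, rfl⟩ ⟨t, ⟨-, G, hG, htG⟩, rfl⟩ x ⟨hxs, hxt⟩
    rw [Finset.coe_image] at hxs hxt
    obtain ⟨c, hc0, hcs, hc1, rfl⟩ := mem_convexHull_image_iff.1 hxs
    obtain ⟨d, hd0, hdt, hd1, hdc⟩ := mem_convexHull_image_iff.1 hxt
    have hcd : c = d := coeff_unique_points h hw hF hG hc0 hd0 (fun S hS => hcs S fun h => hS (hsF h))
      (fun S hS => hdt S fun h => hS (htG h)) hdc.symm
    subst hcd
    have hsub : point '' ((s ∩ t : Finset Label) : Set Label) ⊆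
        ((s.image point : Finset _) : Set (Fin 6 → ℝ)) ∩ ((t.image point : Finset _) : Set _) := by
      rintro _ ⟨S, hS, rfl⟩
      rw [Finset.mem_coe, Finset.mem_inter] at hS
      simp only [Finset.coe_image]
      exact ⟨⟨S, hS.1, rfl⟩, ⟨S, hS.2, rfl⟩⟩
    refine convexHull_mono hsub (mem_convexHull_image_iff.2 ⟨c, hc0, fun S hS => ?_, hc1, rfl⟩)
    by_cases h : S ∈ s
    · exact hdt S fun h' => hS (Finset.mem_inter.2 ⟨h, h'⟩)
    · exact hcs S h

theorem triangulatesByPoints (h : IsPolytopal 𝓕 (weightedPoint w))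
    (hw : ∀ F ∈ 𝓕, ∀ S ∈ F, 0 < S.card ∧ 0 < w S.card) (hm : ∀ F ∈ 𝓕, ∃ m, ∀ S ∈ F, m ∉ S) :
    TriangulatesByPoints (generatedBy 𝓕) boundarySimplex := by
  refine ⟨?_, geometricComplex h hw, rfl, ?_⟩
  · intro S hS T hT hST
    obtain ⟨F, hF, hSF⟩ := mem_vertices_generatedBy.1 hS
    obtain ⟨G, hG, hTG⟩ := mem_vertices_generatedBy.1 hT
    have hnn : ∀ S T : Label, (0 : ℝ) ≤ (Pi.single S 1 : Label → ℝ) T := fun S T =>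
      (Pi.single_nonneg.2 zero_le_one : (0 : Label → ℝ) ≤ Pi.single S 1) T
    -- Each vertex is a combination of itself alone, so equality of points forces equality of the
    -- two unit vectors.
    have := coeff_unique_points h hw hF hG (hnn S) (hnn T)
      (fun U hU => Pi.single_eq_of_ne (by rintro rfl; exact hU hSF) _)
      (fun U hU => Pi.single_eq_of_ne (by rintro rfl; exact hU hTG) _)
      (by simpa [Pi.single_apply] using hST)
    by_contra hne
    simpa [Pi.single_apply, hne] using congrFun this S
  · ext x
    rw [Geometry.SimplicialComplex.mem_space_iff]
    constructor
    · rintro ⟨_, ⟨s, ⟨-, F, hF, hsF⟩, rfl⟩, hx⟩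
      rw [Finset.coe_image] at hx
      obtain ⟨c, hc0, hcs, hc1, rfl⟩ := mem_convexHull_image_iff.1 hx
      exact sum_points_mem_boundarySimplex hw hm hF hc0 (fun S hS => hcs S fun h => hS (hsF h)) hc1
    · intro hx
      obtain ⟨F, hF, c, hc0, hc, hc1, rfl⟩ := exists_coeff_of_mem_boundarySimplex h hw hm hx
      refine ⟨F.image point, ⟨F, ⟨?_, F, hF, subset_rfl⟩, rfl⟩, ?_⟩
      · rw [← Finset.card_pos, h.card_eq F hF, finrank_euclideanSpace, Fintype.card_fin]
        norm_num
      · rw [Finset.coe_image]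
        exact mem_convexHull_image_iff.2 ⟨c, hc0, hc, hc1, rfl⟩

/-- `S_6` is transitive on labels of a given cardinality, so only the cardinalities that occur
matter. -/
theorem vertices_generatedBy_orbits (R : Set (Finset Label)) :
    vertices (generatedBy (orbits R)) = {S | ∃ r ∈ R, ∃ T ∈ r, S.card = T.card} := by
  ext S
  rw [mem_vertices_generatedBy]
  constructor
  · rintro ⟨_, ⟨g, r, hr, rfl⟩, hS⟩
    obtain ⟨T, hT, rfl⟩ := Finset.mem_image.1 hS
    exact ⟨r, hr, T, hT, card_permLabel g T⟩
  · rintro ⟨r, hr, T, hT, hST⟩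
    obtain ⟨g, rfl⟩ := Equiv.Perm.exists_map_finset_eq T S hST.symm
    exact ⟨_, ⟨g, r, hr, rfl⟩, permLabel_mem_relabel.2 hT⟩

theorem triangulatesByPoints_orbits {R : Set (Finset Label)}
    (h : IsPolytopal (orbits R) (weightedPoint w))
    (hw : ∀ r ∈ R, ∀ S ∈ r, 0 < S.card ∧ 0 < w S.card) (hm : ∀ r ∈ R, ∃ m, ∀ S ∈ r, m ∉ S) :
    TriangulatesByPoints (generatedBy (orbits R)) boundarySimplex := by
  refine triangulatesByPoints h ?_ ?_
  · rintro _ ⟨g, r, hr, rfl⟩ S hS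
    obtain ⟨T, rfl⟩ := exists_permLabel_eq g S
    rw [card_permLabel]
    exact hw r hr T (permLabel_mem_relabel.1 hS)
  · rintro _ ⟨g, r, hr, rfl⟩
    obtain ⟨m, hm⟩ := hm r hr
    refine ⟨g m, fun S hS => ?_⟩
    obtain ⟨T, rfl⟩ := exists_permLabel_eq g S
    rw [mem_permLabel]
    exact hm T (permLabel_mem_relabel.1 hS)

theorem triangulatesByPoints_X6 : TriangulatesByPoints X6 boundarySimplex := by
  rw [X6_eq]
  refine triangulatesByPoints_orbits isPolytopal_X6 ?_ ?_
  · simp only [Set.mem_singleton_iff, forall_eq]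
    decide
  · simp only [Set.mem_singleton_iff, forall_eq]
    decide

theorem triangulatesByPoints_X12 : TriangulatesByPoints X12 boundarySimplex := by
  rw [X12_eq]
  refine triangulatesByPoints_orbits isPolytopal_X12 ?_ ?_
  · simp only [Set.mem_singleton_iff, forall_eq]
    decide
  · simp only [Set.mem_singleton_iff, forall_eq]
    decide

theorem triangulatesByPoints_X32 : TriangulatesByPoints X32 boundarySimplex := by
  rw [X32_eq]
  refine triangulatesByPoints_orbits isPolytopal_X32 ?_ ?_
  · simp only [Set.mem_insert_iff, Set.mem_singleton_iff, forall_eq_or_imp, forall_eq]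
    decide
  · simp only [Set.mem_insert_iff, Set.mem_singleton_iff, forall_eq_or_imp, forall_eq]
    decide

theorem vertices_X6 : vertices X6 = verticesOfCard 1 := by
  rw [X6_eq, vertices_generatedBy_orbits]
  ext S
  simp [rep6, verticesOfCard]

theorem vertices_X12 : vertices X12 = verticesOfCard 1 ∪ verticesOfCard 5 := by
  rw [X12_eq, vertices_generatedBy_orbits]
  ext S
  simp [rep12, verticesOfCard, Finset.card_compl]

theorem vertices_X32 :
    vertices X32 = verticesOfCard 1 ∪ verticesOfCard 3 ∪ verticesOfCard 5 := by
  rw [X32_eq, vertices_generatedBy_orbits]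
  ext S
  simp [repEdge, repVertex, repMiddle, verticesOfCard, Finset.card_compl]
  tauto

theorem vertices_S432 :
    vertices S432 = verticesOfCard 1 ∪ verticesOfCard 3 ∪ verticesOfCard 5 := by
  rw [S432_eq, vertices_generatedBy_orbits]
  ext S
  simp [repStar, repFlipped, repVertex, repMiddle, verticesOfCard, Finset.card_compl]
  tauto

theorem ncard_vertices_X32 : (vertices X32).ncard = 32 := by
  have : vertices X32 =
      ((Finset.univ.filter fun S : Label => S.card = 1 ∨ S.card = 3 ∨ S.card = 5 :
        Finset Label) : Set Label) := by
    rw [vertices_X32]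
    ext S
    simp [verticesOfCard, or_assoc]
  rw [this, Set.ncard_coe_finset]
  decide +kernel

/-- The barycentre of a simplex lies in each face that contains its vertices. -/
theorem point_mem_convexHull_singletons {S T : Label} (hS : S.Nonempty) (hST : S ⊆ T) :
    point S ∈ convexHull ℝ (point '' ((T.image fun i => {i} : Finset Label) : Set Label)) := by
  have h : point S = ∑ i ∈ S, (S.card : ℝ)⁻¹ • point {i} := by
    simp [point, Finset.smul_sum]
  rw [h]
  refine (convex_convexHull ℝ _).sum_mem (fun i _ => by positivity) ?_ fun i hi =>
    subset_convexHull ℝ _ ⟨{i}, by simpa using hST hi, rfl⟩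
  have : (S.card : ℝ) ≠ 0 := by exact_mod_cast hS.card_pos.ne'
  simp [this]

theorem refinesByPoints_generatedBy {𝓖 : Set (Finset Label)}
    (h : ∀ F ∈ 𝓕, ∃ G ∈ 𝓖, G.Nonempty ∧ ∀ S ∈ F, point S ∈ convexHull ℝ (point '' (G : Set Label))) :
    RefinesByPoints (generatedBy 𝓕) (generatedBy 𝓖) := by
  rintro s ⟨-, F, hF, hsF⟩
  obtain ⟨G, hG, hne, hFG⟩ := h F hF
  refine ⟨G, ⟨hne, G, hG, subset_rfl⟩, convexHull_min ?_ (convex_convexHull ℝ _)⟩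
  rintro _ ⟨S, hS, rfl⟩
  exact hFG S (hsF hS)

theorem point_permLabel_apply (g : Equiv.Perm (Fin 6)) (S : Label) (i : Fin 6) :
    point (permLabel g S) (g i) = point S i := by
  simp only [point_apply, card_permLabel, indicator, mem_permLabel]

theorem point_mem_convexHull_relabel (g : Equiv.Perm (Fin 6)) {S : Label} {s : Finset Label}
    (h : point S ∈ convexHull ℝ (point '' (s : Set Label))) :
    point (permLabel g S) ∈ convexHull ℝ (point '' (relabel g s : Set Label)) := by
  have hp : ∀ T, LinearMap.funLeft ℝ ℝ g.symm (point T) = point (permLabel g T) := fun T => by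
    funext i
    obtain ⟨i, rfl⟩ := g.surjective i
    simp [LinearMap.funLeft_apply, point_permLabel_apply]
  have := Set.mem_image_of_mem (LinearMap.funLeft ℝ ℝ g.symm) h
  rw [LinearMap.image_convexHull, Set.image_image, hp] at this
  simpa only [hp, relabel, Finset.coe_image, Set.image_image] using this

theorem refinesByPoints_orbits {R Q : Set (Finset Label)}
    (h : ∀ r ∈ R, ∃ q ∈ orbits Q, q.Nonempty ∧
      ∀ S ∈ r, point S ∈ convexHull ℝ (point '' (q : Set Label))) :
    RefinesByPoints (generatedBy (orbits R)) (generatedBy (orbits Q)) := by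
  refine refinesByPoints_generatedBy ?_
  rintro _ ⟨g, r, hr, rfl⟩
  obtain ⟨q, hq, hne, hrq⟩ := h r hr
  refine ⟨_, relabel_mem_orbits g hq, hne.image _, fun S hS => ?_⟩
  obtain ⟨T, rfl⟩ := exists_permLabel_eq g S
  exact point_mem_convexHull_relabel g (hrq T (permLabel_mem_relabel.1 hS))

theorem refinesByPoints_X12_X6 : RefinesByPoints X12 X6 := by
  rw [X12_eq, X6_eq]
  -- All labels of `rep12` are subsets of `{4}ᶜ`, so their barycentres lie in the facet of `X6` that
  -- omits `e_4`.
  refine refinesByPoints_orbits fun r hr => ⟨({4}ᶜ : Label).image fun i => {i},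
    ⟨Equiv.swap 4 5, rep6, rfl, by decide⟩, ⟨{0}, by decide⟩, fun S hS => ?_⟩
  have h : ∀ S ∈ rep12, S.Nonempty ∧ S ⊆ {4}ᶜ := by decide
  obtain ⟨hne, hsub⟩ := h S (hr ▸ hS)
  exact point_mem_convexHull_singletons hne hsub

/-- Apart from the apex `{4}ᶜ`, every label of a representative is a subset of `{0, 1, 2, 3}`, and
its barycentre lies in that tetrahedron of `rep12`. -/
theorem refinesByPoints_X32_X12 : RefinesByPoints X32 X12 := by
  rw [X32_eq, X12_eq]
  refine refinesByPoints_orbits fun r hr => ⟨_, subset_orbits _ rfl, ⟨{0}, by decide⟩, fun S hS => ?_⟩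
  have h : ∀ r ∈ ({repEdge, repVertex, repMiddle} : Set (Finset Label)), ∀ S ∈ r,
      S.Nonempty ∧ S ⊆ {0, 1, 2, 3} ∨ S = {4}ᶜ := by
    simp only [Set.mem_insert_iff, Set.mem_singleton_iff, forall_eq_or_imp, forall_eq]
    decide
  rcases h r hr S hS with ⟨hne, hsub⟩ | rfl
  · refine convexHull_mono (Set.image_mono ?_) (point_mem_convexHull_singletons hne hsub)
    rw [Finset.coe_subset]
    decide
  · exact subset_convexHull ℝ _ ⟨_, by decide, rfl⟩

end Geometric

/-! ### Simultaneous flips -/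

section Flips

variable {V : Type*} [DecidableEq V]

/-- The link condition confines the whole star of `A` to the labels of the flip, so nothing outside
`A ∪ B` is lost when `A` is removed. -/
theorem FlipAdmissible.subset_union {K : PreAbstractSimplicialComplex V} {A B s : Finset V}
    (h : FlipAdmissible K A B) (hs : s ∈ K.faces) (hA : A ⊆ s) : s ⊆ A ∪ B := by
  rcases (s \ A).eq_empty_or_nonempty with h0 | hne
  · exact (Finset.sdiff_eq_empty_iff_subset.1 h0).trans Finset.subset_union_left
  · have := (h.link (s \ A)).1 ⟨hne, Finset.sdiff_disjoint, by
      rwa [Finset.sdiff_union_of_subset hA]⟩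
    rw [← Finset.union_sdiff_of_subset hA]
    exact Finset.union_subset_union_right this.2.1

/-- Admissible flips that do not interfere with each other. -/
structure CompatibleFlips (K : PreAbstractSimplicialComplex V) (P : Set (Finset V × Finset V)) :
    Prop where
  admissible : ∀ p ∈ P, FlipAdmissible K p.1 p.2
  separated : ∀ p ∈ P, ∀ q ∈ P, q ≠ p → ¬ q.1 ⊆ p.1 ∪ p.2 ∧ ¬ q.2 ⊆ p.1 ∪ p.2

/-- The flip at `p` only removes or adds simplices inside `p.1 ∪ p.2`. By separation neither simplex
of another pair lies there, so the star of `q.1` is untouched and `q.2` does not appear. -/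
theorem CompatibleFlips.flip {K : PreAbstractSimplicialComplex V} {P : Set (Finset V × Finset V)}
    {p : Finset V × Finset V} (hp : p ∉ P) (h : CompatibleFlips K (insert p P)) :
    CompatibleFlips (flip K p.1 p.2) P := by
  refine ⟨fun q hq => ?_, fun r hr q hq => h.separated r (Or.inr hr) q (Or.inr hq)⟩
  have hap := h.admissible p (Or.inl rfl)
  have haq := h.admissible q (Or.inr hq)
  obtain ⟨h1, h2⟩ := h.separated p (Or.inl rfl) q (Or.inr hq) fun he => hp (he ▸ hq)
  refine ⟨⟨fun h' => h1 (hap.subset_union haq.mem h'), Or.inl haq.mem⟩, haq.nonempty, haq.disjoint,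
    ?_, fun t => ?_⟩
  · rintro ⟨-, h' | h'⟩
    · exact haq.notMem h'
    · exact h2 h'.2
  · constructor
    · rintro ⟨hne, hd, -, h' | h'⟩
      · exact (haq.link t).1 ⟨hne, hd, h'⟩
      · exact absurd (Finset.subset_union_right.trans h'.2) h1
    · intro ht
      obtain ⟨hne, hd, h'⟩ := (haq.link t).2 ht
      exact ⟨hne, hd, fun hA => h1 (Finset.subset_union_right.trans (hap.subset_union h' hA)),
        Or.inl h'⟩

/-- The result of performing all the flips in `P`. -/
def flipAll (K : PreAbstractSimplicialComplex V) (P : Set (Finset V × Finset V)) :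
    PreAbstractSimplicialComplex V where
  faces := {s | (∀ p ∈ P, ¬ p.1 ⊆ s) ∧ (s ∈ K.faces ∨ s.Nonempty ∧ ∃ p ∈ P, s ⊆ p.1 ∪ p.2)}
  isRelLowerSet_faces := by
    rintro s ⟨hA, h⟩
    have hA' : ∀ t ⊆ s, ∀ p ∈ P, ¬ p.1 ⊆ t := fun t hts p hp h' => hA p hp (h'.trans hts)
    rcases h with h | ⟨hs, p, hp, h⟩
    · exact ⟨(K.isRelLowerSet_faces h).1, fun t hts ht =>
        ⟨hA' t hts, Or.inl ((K.isRelLowerSet_faces h).2 hts ht)⟩⟩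
    · exact ⟨hs, fun t hts ht => ⟨hA' t hts, Or.inr ⟨ht, p, hp, hts.trans h⟩⟩⟩

/-- By separation, simplices added by a flip in `P` do not contain `p.1`, so removing the faces over
`p.1` first or together with the others makes no difference. -/
theorem CompatibleFlips.flipAll_flip {K : PreAbstractSimplicialComplex V}
    {P : Set (Finset V × Finset V)} {p : Finset V × Finset V} (hp : p ∉ P)
    (h : CompatibleFlips K (insert p P)) :
    flipAll (RP416.flip K p.1 p.2) P = flipAll K (insert p P) := by
  ext s
  constructor
  · rintro ⟨h1, ⟨h2, h3⟩ | ⟨hne, q, hq, h2⟩⟩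
    · refine ⟨Set.forall_mem_insert.2 ⟨h2, h1⟩, h3.imp_right ?_⟩
      exact fun h3 => ⟨h3.1, p, Or.inl rfl, h3.2⟩
    · refine ⟨Set.forall_mem_insert.2 ⟨fun h' => ?_, h1⟩, Or.inr ⟨hne, q, Or.inr hq, h2⟩⟩
      exact (h.separated q (Or.inr hq) p (Or.inl rfl) fun he => hp (he ▸ hq)).1 (h'.trans h2)
  · rintro ⟨h1, h2⟩
    obtain ⟨h1p, h1⟩ := Set.forall_mem_insert.1 h1
    refine ⟨h1, ?_⟩
    rcases h2 with h2 | ⟨hne, q, rfl | hq, h2⟩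
    · exact Or.inl ⟨h1p, Or.inl h2⟩
    · exact Or.inl ⟨h1p, Or.inr ⟨hne, h2⟩⟩
    · exact Or.inr ⟨hne, q, hq, h2⟩

theorem CompatibleFlips.flipsTo {l : List (Finset V × Finset V)} (hl : l.Nodup) :
    ∀ {K : PreAbstractSimplicialComplex V}, CompatibleFlips K {p | p ∈ l} →
      FlipsTo K l (flipAll K {p | p ∈ l}) := by
  induction l with
  | nil =>
    intro K _
    change K = _
    ext s
    simp [flipAll]
  | cons p l ih =>
    intro K h
    have hins : {q | q ∈ p :: l} = insert p {q | q ∈ l} := by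
      ext
      simp
    rw [hins] at h ⊢
    obtain ⟨hp, hl⟩ := List.nodup_cons.1 hl
    refine ⟨h.admissible p (Or.inl rfl), ?_⟩
    rw [← h.flipAll_flip hp]
    exact ih hl (h.flip hp)

/-- The result `flipAll` depends on the set of pairs only, hence not on the order. -/
theorem CompatibleFlips.simultaneousFlip {K : PreAbstractSimplicialComplex V}
    {P : Finset (Finset V × Finset V)} (h : CompatibleFlips K P) :
    SimultaneousFlip K P (flipAll K P) := by
  intro l hl hlP
  have : (P : Set (Finset V × Finset V)) = {p | p ∈ l} := by
    rw [← hlP, List.coe_toFinset]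
  rw [this] at h ⊢
  exact h.flipsTo hl

/-- The facets of a complex after flips. -/
def flippedFacets (𝓕 : Set (Finset V)) (P : Set (Finset V × Finset V)) : Set (Finset V) :=
  {F | F ∈ 𝓕 ∧ ∀ p ∈ P, ¬ p.1 ⊆ F} ∪ {G | ∃ p ∈ P, ∃ a ∈ p.1, G = p.1.erase a ∪ p.2}

/-- A criterion for flips to be simultaneously admissible, in terms of the facets. -/
theorem simultaneousFlip_generatedBy {𝓕 : Set (Finset V)} {P : Finset (Finset V × Finset V)}
    (hA : ∀ p ∈ P, p.1.Nonempty) (hB : ∀ p ∈ P, p.2.Nonempty)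
    (hdisj : ∀ p ∈ P, Disjoint p.1 p.2)
    (hstar : ∀ p ∈ P, ∀ F ∈ 𝓕, p.1 ⊆ F → ∃ b ∈ p.2, F = p.1 ∪ p.2.erase b)
    (hmem : ∀ p ∈ P, ∀ b ∈ p.2, p.1 ∪ p.2.erase b ∈ 𝓕)
    (hnot : ∀ p ∈ P, ∀ F ∈ 𝓕, ¬ p.2 ⊆ F)
    (hsep : ∀ p ∈ P, ∀ q ∈ P, q ≠ p → ¬ q.1 ⊆ p.1 ∪ p.2 ∧ ¬ q.2 ⊆ p.1 ∪ p.2) :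
    SimultaneousFlip (generatedBy 𝓕) P (generatedBy (flippedFacets 𝓕 P)) := by
  have hcomp : CompatibleFlips (generatedBy 𝓕) (P : Set (Finset V × Finset V)) := by
    refine ⟨fun p hp => ⟨?_, hB p hp, hdisj p hp, ?_, fun t => ?_⟩, hsep⟩
    · obtain ⟨b, hb⟩ := hB p hp
      exact ⟨hA p hp, _, hmem p hp b hb, Finset.subset_union_left⟩
    · rintro ⟨-, F, hF, h⟩
      exact hnot p hp F hF h
    · constructor
      · rintro ⟨hne, hd, -, F, hF, htF⟩
        obtain ⟨b, hb, rfl⟩ := hstar p hp F hF (Finset.subset_union_right.trans htF)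
        have ht : t ⊆ p.2.erase b := fun v hv =>
          (Finset.mem_union.1 (htF (Finset.mem_union_left _ hv))).resolve_left
            (Finset.disjoint_left.1 hd hv)
        exact ⟨hne, ht.trans_ssubset (Finset.erase_ssubset hb)⟩
      · rintro ⟨hne, ht⟩
        obtain ⟨b, hb, hbt⟩ := Finset.exists_of_ssubset ht
        refine ⟨hne, (hdisj p hp).symm.mono_left ht.1, hne.mono Finset.subset_union_left, _,
          hmem p hp b hb, Finset.union_subset
            (Finset.Subset.trans (Finset.subset_erase.2 ⟨ht.1, hbt⟩) Finset.subset_union_right)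
            Finset.subset_union_left⟩
  have hall : flipAll (generatedBy 𝓕) P = generatedBy (flippedFacets 𝓕 P) := by
    ext s
    constructor
    · rintro ⟨h1, h2⟩
      -- A simplex in the ball of `p` that does not contain `p.1` misses some vertex `a` of it, so
      -- it lies in the new facet opposite `a`.
      have key : s.Nonempty → ∀ p ∈ P, s ⊆ p.1 ∪ p.2 → s ∈ (generatedBy (flippedFacets 𝓕 P)).faces := by
        intro hne p hp hs
        obtain ⟨a, ha, has⟩ := Finset.not_subset.1 (h1 p hp)
        refine ⟨hne, _, Or.inr ⟨p, hp, a, ha, rfl⟩, fun v hv => ?_⟩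
        rcases Finset.mem_union.1 (hs hv) with hv' | hv'
        · refine Finset.mem_union_left _ (Finset.mem_erase.2 ⟨?_, hv'⟩)
          rintro rfl
          exact has hv
        · exact Finset.mem_union_right _ hv'
      rcases h2 with ⟨hne, F, hF, hs⟩ | ⟨hne, p, hp, hs⟩
      · by_cases h : ∀ p ∈ P, ¬ p.1 ⊆ F
        · exact ⟨hne, F, Or.inl ⟨hF, h⟩, hs⟩
        · push Not at h
          obtain ⟨p, hp, hpF⟩ := h
          refine key hne p hp (hs.trans ?_)
          obtain ⟨b, -, rfl⟩ := hstar p hp F hF hpF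
          exact Finset.union_subset_union_right (Finset.erase_subset b p.2)
      · exact key hne p hp hs
    · rintro ⟨hne, F, ⟨hF, h⟩ | ⟨p, hp, a, ha, rfl⟩, hs⟩
      · exact ⟨fun p hp hps => h p hp (hps.trans hs), Or.inl ⟨hne, F, hF, hs⟩⟩
      · have hsub : s ⊆ p.1 ∪ p.2 :=
          hs.trans (Finset.union_subset_union_left (Finset.erase_subset a p.1))
        refine ⟨fun q hq hqs => ?_, Or.inr ⟨hne, p, hp, hsub⟩⟩
        by_cases he : q = p
        · subst he
          rcases Finset.mem_union.1 (hs (hqs ha)) with h | h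
          · exact Finset.notMem_erase a q.1 h
          · exact Finset.disjoint_left.1 (hdisj q hp) ha h
        · exact (hsep p hp q hq he).1 (hqs.trans hsub)
  rw [← hall]
  exact hcomp.simultaneousFlip

end Flips

/-! ### Flips along an orbit of the symmetric group -/

section Orbits

theorem relabel_swap_mem_orbits {R : Set (Finset Label)} {s : Finset Label}
    (h : ∃ i j : Fin 6, ∃ r ∈ R, s = relabel (Equiv.swap i j) r) : s ∈ orbits R := by
  obtain ⟨i, j, r, hr, rfl⟩ := h
  exact ⟨_, r, hr, rfl⟩

/-- A criterion for simultaneous flips at an orbit, to be checked on representatives. -/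
theorem simultaneousFlip_orbits {R Q : Set (Finset Label)} {P : Finset (Finset Label × Finset Label)}
    {A B : Finset Label} (hP : ∀ p, p ∈ P ↔ ∃ g, p = (relabel g A, relabel g B))
    (hA : A.Nonempty) (hB : B.Nonempty) (hdisj : Disjoint A B)
    (hstar : ∀ p ∈ P, ∀ r ∈ R, p.1 ⊆ r → ∃ b ∈ p.2, r = p.1 ∪ p.2.erase b)
    (hmem : ∀ b ∈ B, ∃ i j : Fin 6, ∃ r ∈ R, A ∪ B.erase b = relabel (Equiv.swap i j) r)
    (hnot : ∀ p ∈ P, ∀ r ∈ R, ¬ p.2 ⊆ r)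
    (hsep : ∀ q ∈ P, q ≠ (A, B) → ¬ q.1 ⊆ A ∪ B ∧ ¬ q.2 ⊆ A ∪ B)
    (hR : ∀ r ∈ R, r ∈ Q ∨ ∃ p ∈ P, p.1 ⊆ r)
    (hnew : ∀ a ∈ A, ∃ i j : Fin 6, ∃ q ∈ Q, A.erase a ∪ B = relabel (Equiv.swap i j) q)
    (hQ : ∀ q ∈ Q, (q ∈ R ∧ ∀ p ∈ P, ¬ p.1 ⊆ q) ∨ ∃ a ∈ A, q = A.erase a ∪ B) :
    SimultaneousFlip (generatedBy (orbits R)) P (generatedBy (orbits Q)) := by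
  -- The set of pairs is invariant, so in a condition on a pair and a facet the facet may be taken
  -- to be a representative while the pair still runs through all of `P`; alternatively the pair may
  -- be normalised.
  have hPinv : ∀ g, ∀ p ∈ P, ∃ q ∈ P, p = (relabel g q.1, relabel g q.2) := by
    intro g p hp
    obtain ⟨h, rfl⟩ := (hP p).1 hp
    exact ⟨_, (hP _).2 ⟨g⁻¹ * h, rfl⟩, by simp only [← relabel_mul, mul_inv_cancel_left]⟩
  -- Both sides are invariant. `hR` and `hnew` show that flipping gives only facets in `Q`-orbits,
  -- and `hQ` that each of them survives or is created.
  have hflip : flippedFacets (orbits R) P = orbits Q := by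
    ext F
    constructor
    · rintro (⟨⟨g, r, hr, rfl⟩, h⟩ | ⟨p, hp, a, ha, rfl⟩)
      · rcases hR r hr with hrQ | ⟨p, hp, hpr⟩
        · exact ⟨g, r, hrQ, rfl⟩
        · obtain ⟨h', rfl⟩ := (hP p).1 hp
          refine absurd ?_ (h _ ((hP _).2 ⟨g * h', rfl⟩))
          rw [relabel_mul]
          exact relabel_mono hpr
      · obtain ⟨g, rfl⟩ := (hP p).1 hp
        obtain ⟨a, ha, rfl⟩ := Finset.mem_image.1 ha
        rw [← relabel_erase, ← relabel_union]
        exact relabel_mem_orbits g (relabel_swap_mem_orbits (hnew a (permLabel_mem_relabel.1 ha)))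
    · rintro ⟨g, q, hq, rfl⟩
      rcases hQ q hq with ⟨hqR, h⟩ | ⟨a, ha, rfl⟩
      · refine Or.inl ⟨⟨g, q, hqR, rfl⟩, fun p hp hpq => ?_⟩
        obtain ⟨p', hp', rfl⟩ := hPinv g p hp
        exact h p' hp' (relabel_subset_relabel.1 hpq)
      · refine Or.inr ⟨_, (hP _).2 ⟨g, rfl⟩, permLabel g a, permLabel_mem_relabel.2 ha, ?_⟩
        rw [← relabel_erase, ← relabel_union]
  rw [← hflip]
  apply simultaneousFlip_generatedBy
  · intro p hp
    obtain ⟨g, rfl⟩ := (hP p).1 hp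
    exact hA.image _
  · intro p hp
    obtain ⟨g, rfl⟩ := (hP p).1 hp
    exact hB.image _
  · intro p hp
    obtain ⟨g, rfl⟩ := (hP p).1 hp
    exact (Finset.disjoint_image (permLabel_injective g)).2 hdisj
  · rintro p hp _ ⟨g, r, hr, rfl⟩ hpr
    obtain ⟨p, hp', rfl⟩ := hPinv g p hp
    obtain ⟨b, hb, he⟩ := hstar p hp' r hr (relabel_subset_relabel.1 hpr)
    refine ⟨permLabel g b, permLabel_mem_relabel.2 hb, ?_⟩
    rw [← relabel_erase, ← relabel_union, ← he]
  · rintro p hp b hb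
    obtain ⟨g, rfl⟩ := (hP p).1 hp
    obtain ⟨b, hb, rfl⟩ := Finset.mem_image.1 hb
    rw [← relabel_erase, ← relabel_union]
    exact relabel_mem_orbits g (relabel_swap_mem_orbits (hmem b (permLabel_mem_relabel.1 hb)))
  · rintro p hp _ ⟨g, r, hr, rfl⟩ hpr
    obtain ⟨p, hp', rfl⟩ := hPinv g p hp
    exact hnot p hp' r hr (relabel_subset_relabel.1 hpr)
  · intro p hp q hq hqp
    obtain ⟨g, rfl⟩ := (hP p).1 hp
    obtain ⟨q, hq', rfl⟩ := hPinv g q hq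
    rw [← relabel_union, relabel_subset_relabel, relabel_subset_relabel]
    refine hsep q hq' ?_
    rintro rfl
    exact hqp rfl

theorem relabel_image (g : Equiv.Perm (Fin 6)) (s : Label) {f f' : Fin 6 → Label}
    (h : ∀ i, permLabel g (f i) = f' (g i)) :
    relabel g (s.image f) = (permLabel g s).image f' := by
  rw [relabel, permLabel, Finset.map_eq_image, Finset.image_image, Finset.image_image]
  exact Finset.image_congr fun i _ => h i

/-- The pair of `facetStarrings` at a facet. -/
def starringPair (i : Fin 6) : Finset Label × Finset Label :=
  ((Finset.univ.erase i).image fun j => {j}, {{i}ᶜ})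

theorem starringPair_apply (g : Equiv.Perm (Fin 6)) (i : Fin 6) :
    starringPair (g i) = (relabel g (starringPair i).1, relabel g (starringPair i).2) := by
  simp only [starringPair, relabel_singleton, permLabel_compl, permLabel_singleton]
  rw [relabel_image g _ (permLabel_singleton g), ← Finset.sdiff_singleton_eq_erase,
    ← Finset.sdiff_singleton_eq_erase, ← Finset.compl_eq_univ_sdiff, ← Finset.compl_eq_univ_sdiff,
    permLabel_compl, permLabel_singleton]

/-- The pairs of `firstFlips`. -/
def firstPair (i j k : Fin 6) : Finset Label × Finset Label :=
  ({{i}, {j}, {k}ᶜ}, (Finset.univ \ {i, j, k}).image fun l => {i, j, l})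

theorem firstPair_apply (g : Equiv.Perm (Fin 6)) (i j k : Fin 6) :
    firstPair (g i) (g j) (g k) =
      (relabel g (firstPair i j k).1, relabel g (firstPair i j k).2) := by
  simp only [firstPair, relabel_singleton, relabel_insert, permLabel_compl, permLabel_singleton]
  rw [relabel_image g _ (f' := fun l => {g i, g j, l}) fun l => by simp,
    ← Finset.compl_eq_univ_sdiff, ← Finset.compl_eq_univ_sdiff]
  simp only [permLabel_compl, permLabel_insert, permLabel_singleton]

/-- The pairs of `secondFlips`. -/
def secondPair (i j : Fin 6) : Finset Label × Finset Label :=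
  ({{i}, {j}}, (Finset.univ \ {i, j}).image fun l => {i, j, l})

theorem secondPair_apply (g : Equiv.Perm (Fin 6)) (i j : Fin 6) :
    secondPair (g i) (g j) = (relabel g (secondPair i j).1, relabel g (secondPair i j).2) := by
  simp only [secondPair, relabel_singleton, relabel_insert, permLabel_singleton]
  rw [relabel_image g _ (f' := fun l => {g i, g j, l}) fun l => by simp,
    ← Finset.compl_eq_univ_sdiff, ← Finset.compl_eq_univ_sdiff]
  simp only [permLabel_compl, permLabel_insert, permLabel_singleton]

/-- A starring is a flip whose `B` is a single new vertex: the boundary of `B` is empty, so the link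
condition says that `A` is a facet. The pair at 4 is the one that produces `rep12`. -/
theorem simultaneousFlip_facetStarrings : SimultaneousFlip X6 facetStarrings X12 := by
  rw [X6_eq, X12_eq]
  have hP : ∀ q : Finset Label × Finset Label → Prop,
      (∀ p ∈ facetStarrings, q p) ↔ ∀ i, q (starringPair i) := fun q => by
    simp [facetStarrings, starringPair]
  have hP' : ∀ q : Finset Label × Finset Label → Prop,
      (∃ p ∈ facetStarrings, q p) ↔ ∃ i, q (starringPair i) := fun q => by
    simp [facetStarrings, starringPair]
  apply simultaneousFlip_orbits (A := (starringPair 4).1) (B := (starringPair 4).2)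
  · intro p
    constructor
    · intro hp
      obtain ⟨i, -, rfl⟩ := Finset.mem_image.1 hp
      exact ⟨Equiv.swap 4 i, by rw [← starringPair_apply, Equiv.swap_apply_left]; rfl⟩
    · rintro ⟨g, rfl⟩
      rw [← starringPair_apply]
      exact Finset.mem_image_of_mem _ (Finset.mem_univ _)
  · decide
  · decide
  · decide
  · simp only [Set.mem_singleton_iff, forall_eq, hP]
    decide +kernel
  · simp only [Set.mem_singleton_iff, exists_eq_left]
    decide +kernel
  · simp only [Set.mem_singleton_iff, forall_eq, hP]
    decide +kernel
  · simp only [hP]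
    decide +kernel
  · simp only [Set.mem_singleton_iff, forall_eq, hP']
    decide +kernel
  · simp only [Set.mem_singleton_iff, exists_eq_left]
    decide +kernel
  · simp only [Set.mem_singleton_iff, forall_eq, hP]
    decide +kernel

/-- The complex after the first round of flips. -/
def flippedX32 : PreAbstractSimplicialComplex Label :=
  generatedBy (orbits {repNew, repMiddle, repFlipped, repVertex})

/-- The facets around the triangle `A` are of the edge type and all disappear. Deleting `{4}ᶜ` from
`A` gives `repNew`; deleting `{0}` or `{1}` gives facets in the orbit of `repFlipped`. -/
theorem simultaneousFlip_firstFlips : SimultaneousFlip X32 firstFlips flippedX32 := by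
  rw [X32_eq, flippedX32]
  have hP : ∀ q : Finset Label × Finset Label → Prop,
      (∀ p ∈ firstFlips, q p) ↔ ∀ i j k, [i, j, k].Nodup → q (firstPair i j k) := fun q => by
    simp only [firstFlips, Finset.forall_mem_image, Finset.mem_filter, Finset.mem_univ, true_and,
      Prod.forall]
    rfl
  have hP' : ∀ q : Finset Label × Finset Label → Prop,
      (∃ p ∈ firstFlips, q p) ↔ ∃ i j k, [i, j, k].Nodup ∧ q (firstPair i j k) := fun q => by
    simp only [firstFlips, Finset.exists_mem_image, Finset.mem_filter, Finset.mem_univ, true_and,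
      Prod.exists]
    rfl
  apply simultaneousFlip_orbits (A := (firstPair 0 1 4).1) (B := (firstPair 0 1 4).2)
  · intro p
    constructor
    · intro hp
      obtain ⟨⟨i, j, k⟩, h, rfl⟩ := Finset.mem_image.1 hp
      have h' : [i, j, k].Nodup := (Finset.mem_filter.1 h).2
      obtain ⟨g, rfl, rfl, rfl⟩ := exists_perm_extending_three h'
      -- The reference pair uses the indices 0, 1, 4, whereas `g` prescribes the images of 0, 1, 2.
      refine ⟨g * Equiv.swap 2 4, ?_⟩
      rw [← firstPair_apply]
      rfl
    · rintro ⟨g, rfl⟩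
      rw [← firstPair_apply]
      refine Finset.mem_image.2 ⟨(g 0, g 1, g 4), Finset.mem_filter.2 ⟨Finset.mem_univ _, ?_⟩, rfl⟩
      exact nodup_map g (l := [0, 1, 4]) (by decide)
  · decide
  · decide
  · decide
  · simp only [Set.mem_insert_iff, Set.mem_singleton_iff, forall_eq_or_imp, forall_eq, hP]
    decide +kernel
  · simp only [Set.mem_insert_iff, Set.mem_singleton_iff, exists_eq_or_imp, exists_eq_left]
    decide +kernel
  · simp only [Set.mem_insert_iff, Set.mem_singleton_iff, forall_eq_or_imp, forall_eq, hP]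
    decide +kernel
  · simp only [hP]
    decide +kernel
  · simp only [Set.mem_insert_iff, Set.mem_singleton_iff, forall_eq_or_imp, forall_eq, hP']
    decide +kernel
  · simp only [Set.mem_insert_iff, Set.mem_singleton_iff, exists_eq_or_imp, exists_eq_left]
    decide +kernel
  · simp only [Set.mem_insert_iff, Set.mem_singleton_iff, forall_eq_or_imp, forall_eq, hP]
    refine ⟨?_, ?_, ?_, ?_⟩ <;> decide +kernel

/-- After the first round the facets containing an edge `[e_i, e_j]` are exactly those in the orbit
of `repNew`, four around each edge. They are exchanged for two facets in the orbit of `repStar`. -/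
theorem simultaneousFlip_secondFlips : SimultaneousFlip flippedX32 secondFlips S432 := by
  rw [S432_eq, flippedX32]
  have hP : ∀ q : Finset Label × Finset Label → Prop,
      (∀ p ∈ secondFlips, q p) ↔ ∀ i j, i ≠ j → q (secondPair i j) := fun q => by
    simp only [secondFlips, Finset.forall_mem_image, Finset.mem_filter, Finset.mem_univ, true_and,
      Prod.forall]
    rfl
  have hP' : ∀ q : Finset Label × Finset Label → Prop,
      (∃ p ∈ secondFlips, q p) ↔ ∃ i j, i ≠ j ∧ q (secondPair i j) := fun q => by
    simp only [secondFlips, Finset.exists_mem_image, Finset.mem_filter, Finset.mem_univ, true_and,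
      Prod.exists]
    rfl
  apply simultaneousFlip_orbits (A := (secondPair 0 1).1) (B := (secondPair 0 1).2)
  · intro p
    constructor
    · intro hp
      obtain ⟨⟨i, j⟩, h, rfl⟩ := Finset.mem_image.1 hp
      have h' : i ≠ j := (Finset.mem_filter.1 h).2
      obtain ⟨g, rfl, rfl⟩ := exists_perm_extending_two h'
      exact ⟨g, by rw [← secondPair_apply]; rfl⟩
    · rintro ⟨g, rfl⟩
      rw [← secondPair_apply]
      exact Finset.mem_image.2 ⟨(g 0, g 1), Finset.mem_filter.2
        ⟨Finset.mem_univ _, g.injective.ne (by decide)⟩, rfl⟩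
  · decide
  · decide
  · decide
  · simp only [Set.mem_insert_iff, Set.mem_singleton_iff, forall_eq_or_imp, forall_eq, hP]
    decide +kernel
  · simp only [Set.mem_insert_iff, Set.mem_singleton_iff, exists_eq_or_imp, exists_eq_left]
    decide +kernel
  · simp only [Set.mem_insert_iff, Set.mem_singleton_iff, forall_eq_or_imp, forall_eq, hP]
    decide +kernel
  · simp only [hP]
    decide +kernel
  · simp only [Set.mem_insert_iff, Set.mem_singleton_iff, forall_eq_or_imp, forall_eq, hP']
    decide +kernel
  · simp only [Set.mem_insert_iff, Set.mem_singleton_iff, exists_eq_or_imp, exists_eq_left]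
    decide +kernel
  · simp only [Set.mem_insert_iff, Set.mem_singleton_iff, forall_eq_or_imp, forall_eq, hP]
    refine ⟨?_, ?_, ?_, ?_⟩ <;> decide +kernel

end Orbits

/-! ### The facets of `S432` and the antipodal map -/

section Facets

variable {V W : Type*} [DecidableEq W]

/-- Generators of equal cardinality cannot contain one another properly. -/
theorem facets_generatedBy {𝓕 : Set (Finset V)} {n : ℕ} (hn : 0 < n) (h : ∀ F ∈ 𝓕, F.card = n) :
    facets (generatedBy 𝓕) = 𝓕 := by
  have hmem : ∀ F ∈ 𝓕, F ∈ (generatedBy 𝓕).faces := fun F hF =>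
    ⟨Finset.card_pos.1 (by rw [h F hF]; exact hn), F, hF, subset_rfl⟩
  ext s
  constructor
  · rintro ⟨⟨-, F, hF, hs⟩, hmax⟩
    exact hmax F (hmem F hF) hs ▸ hF
  · intro hs
    refine ⟨hmem s hs, ?_⟩
    rintro t ⟨-, F, hF, ht⟩ hst
    have : s = F := Finset.eq_of_subset_of_card_le (hst.trans ht) (by rw [h s hs, h F hF])
    exact hst.antisymm (this ▸ ht)

theorem map_generatedBy (𝓕 : Set (Finset V)) (f : V → W) :
    (generatedBy 𝓕).map f = generatedBy ((fun F => F.image f) '' 𝓕) := by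
  ext s
  constructor
  · rintro ⟨t, ⟨hne, F, hF, ht⟩, rfl⟩
    exact ⟨hne.image f, _, ⟨F, hF, rfl⟩, Finset.image_subset_image ht⟩
  · rintro ⟨hne, _, ⟨F, hF, rfl⟩, hs⟩
    obtain ⟨t, ht, rfl⟩ := Finset.subset_image_iff.1 hs
    exact ⟨t, ⟨Finset.image_nonempty.1 hne, F, hF, ht⟩, rfl⟩

theorem map_map {X : Type*} [DecidableEq X] (K : PreAbstractSimplicialComplex V) (f : V → W)
    (f' : W → X) : (K.map f).map f' = K.map (f' ∘ f) := by
  ext s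
  constructor
  · rintro ⟨_, ⟨t, ht, rfl⟩, rfl⟩
    exact ⟨t, ht, Finset.image_image.symm⟩
  · rintro ⟨t, ht, rfl⟩
    exact ⟨_, ⟨t, ht, rfl⟩, Finset.image_image⟩

/-- The facets of `S432`. -/
def facets432 : Set (Finset Label) := orbits {repStar, repMiddle, repFlipped, repVertex}

theorem facets432_eq :
    facets432 = orbits {repStar} ∪ orbits {repMiddle} ∪ orbits {repFlipped} ∪ orbits {repVertex} := by
  rw [facets432, Set.insert_eq, Set.insert_eq, Set.insert_eq, ← Set.union_assoc, ← Set.union_assoc,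
    orbits_union, orbits_union, orbits_union]

theorem card_of_mem_facets432 : ∀ F ∈ facets432, F.card = 5 := by
  rintro _ ⟨g, r, hr, rfl⟩
  rw [card_relabel]
  revert r
  simp only [Set.mem_insert_iff, Set.mem_singleton_iff, forall_eq_or_imp, forall_eq]
  decide

theorem facets_S432 : facets S432 = facets432 := by
  rw [S432_eq]
  exact facets_generatedBy (by norm_num) card_of_mem_facets432

theorem map_permLabel_S432 (g : Equiv.Perm (Fin 6)) : S432.map (permLabel g) = S432 := by
  rw [S432_eq, map_generatedBy]
  congr 1
  ext s
  constructor
  · rintro ⟨F, hF, rfl⟩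
    exact relabel_mem_orbits g hF
  · intro hs
    exact ⟨relabel g⁻¹ s, relabel_mem_orbits _ hs, relabel_relabel_inv g s⟩

/-- The sum of the third powers of the degrees of the coordinates in a set of labels. -/
def degreeCubes (s : Finset Label) : ℕ := ∑ i, (s.filter (i ∈ ·)).card ^ 3

theorem degreeCubes_relabel (g : Equiv.Perm (Fin 6)) (s : Finset Label) :
    degreeCubes (relabel g s) = degreeCubes s := by
  rw [degreeCubes, ← Equiv.sum_comp g]
  refine Finset.sum_congr rfl fun i _ => ?_
  rw [relabel, Finset.filter_image, Finset.card_image_of_injective _ (permLabel_injective g)]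
  simp only [mem_permLabel]

theorem degreeCubes_of_mem_orbits {r s : Finset Label} (h : s ∈ orbits {r}) :
    degreeCubes s = degreeCubes r := by
  obtain ⟨g, _, rfl, rfl⟩ := h
  exact degreeCubes_relabel g _

/-- Cubes are needed: the sums of degrees, and of their squares, agree on `repFlipped` and
`repVertex`, while the sums of cubes separate all four types. -/
theorem disjoint_orbits {r r' : Finset Label} (h : degreeCubes r ≠ degreeCubes r') :
    Disjoint (orbits {r}) (orbits {r'}) :=
  Set.disjoint_left.2 fun _ hs hs' =>
    h ((degreeCubes_of_mem_orbits hs).symm.trans (degreeCubes_of_mem_orbits hs'))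

/-- The facet `[e_i, e_{ijl}, …]` of `S432`. -/
def starFacet (i j : Fin 6) : Finset Label :=
  insert {i} ((Finset.univ \ {i, j}).image fun l => {i, j, l})

theorem starFacet_apply (g : Equiv.Perm (Fin 6)) (i j : Fin 6) :
    starFacet (g i) (g j) = relabel g (starFacet i j) := by
  rw [starFacet, starFacet, relabel_insert, permLabel_singleton,
    relabel_image g _ (f' := fun l => {g i, g j, l}) fun l => by simp,
    ← Finset.compl_eq_univ_sdiff, ← Finset.compl_eq_univ_sdiff]
  simp only [permLabel_compl, permLabel_insert, permLabel_singleton]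

/-- The facet `[e_i, f_k, e_{ijl}, …]` of `S432`. -/
def flippedFacet (i j k : Fin 6) : Finset Label :=
  insert {i} (insert {k}ᶜ ((Finset.univ \ {i, j, k}).image fun l => {i, j, l}))

theorem flippedFacet_apply (g : Equiv.Perm (Fin 6)) (i j k : Fin 6) :
    flippedFacet (g i) (g j) (g k) = relabel g (flippedFacet i j k) := by
  rw [flippedFacet, flippedFacet, relabel_insert, relabel_insert, permLabel_compl,
    permLabel_singleton, permLabel_singleton,
    relabel_image g _ (f' := fun l => {g i, g j, l}) fun l => by simp,
    ← Finset.compl_eq_univ_sdiff, ← Finset.compl_eq_univ_sdiff]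
  simp only [permLabel_compl, permLabel_insert, permLabel_singleton]

/-- The letters `l` exhaust the remaining indices, so an ordered pair parametrises these facets. The
parametrisation is injective, which gives the count 30; similarly ordered triples give 120 below. -/
theorem orbits_repStar : orbits {repStar} = {s | ∃ i j, i ≠ j ∧ s = starFacet i j} := by
  have h : repStar = starFacet 0 1 := by decide
  ext s
  constructor
  · rintro ⟨g, _, rfl, rfl⟩
    exact ⟨g 0, g 1, g.injective.ne (by decide), by rw [h, starFacet_apply]⟩
  · rintro ⟨i, j, hij, rfl⟩
    obtain ⟨g, rfl, rfl⟩ := exists_perm_extending_two hij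
    exact ⟨g, _, rfl, by rw [h, starFacet_apply]⟩

theorem orbits_repFlipped :
    orbits {repFlipped} = {s | ∃ i j k, [i, j, k].Nodup ∧ s = flippedFacet i j k} := by
  have h : repFlipped = flippedFacet 0 1 4 := by decide
  have h' : repFlipped = relabel (Equiv.swap 2 4) (flippedFacet 0 1 2) := by decide
  ext s
  constructor
  · rintro ⟨g, _, rfl, rfl⟩
    exact ⟨g 0, g 1, g 4, nodup_map g (l := [0, 1, 4]) (by decide), by rw [h, flippedFacet_apply]⟩
  · rintro ⟨i, j, k, hijk, rfl⟩
    obtain ⟨g, rfl, rfl, rfl⟩ := exists_perm_extending_three hijk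
    refine ⟨g * Equiv.swap 2 4, _, rfl, ?_⟩
    rw [flippedFacet_apply, h', relabel_mul, ← relabel_mul (Equiv.swap 2 4), Equiv.swap_mul_self,
      relabel_one]

theorem ncard_orbits_repStar : (orbits {repStar}).ncard = 30 := by
  have h : orbits {repStar} = (fun p : Fin 6 × Fin 6 => starFacet p.1 p.2) ''
      (Finset.univ.filter fun p : Fin 6 × Fin 6 => p.1 ≠ p.2 : Finset _) := by
    rw [orbits_repStar]
    ext s
    simp [eq_comm]
  rw [h, Set.InjOn.ncard_image, Set.ncard_coe_finset]
  · decide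
  · rintro ⟨i, j⟩ hp ⟨k, l⟩ - he
    have hp' : i ≠ j := by simpa using hp
    obtain ⟨g, rfl, rfl⟩ := exists_perm_extending_two hp'
    obtain ⟨k, rfl⟩ := g.surjective k
    obtain ⟨l, rfl⟩ := g.surjective l
    simp only [starFacet_apply] at he
    -- After transport by `g` injectivity has to be checked at one pair only.
    have key : ∀ k l, starFacet 0 1 = starFacet k l → k = 0 ∧ l = 1 := by decide +kernel
    obtain ⟨rfl, rfl⟩ := key k l (relabel_injective g he)
    rfl

theorem ncard_orbits_repFlipped : (orbits {repFlipped}).ncard = 120 := by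
  have h : orbits {repFlipped} = (fun p : Fin 6 × Fin 6 × Fin 6 => flippedFacet p.1 p.2.1 p.2.2) ''
      (Finset.univ.filter fun p : Fin 6 × Fin 6 × Fin 6 => [p.1, p.2.1, p.2.2].Nodup :
        Finset _) := by
    rw [orbits_repFlipped]
    ext s
    simp only [Set.mem_ofPred_eq, Set.mem_image, Finset.mem_coe, Finset.mem_filter, Finset.mem_univ,
      true_and, Prod.exists, eq_comm]
  rw [h, Set.InjOn.ncard_image, Set.ncard_coe_finset]
  · decide +kernel
  · rintro ⟨i, j, k⟩ hp ⟨l, m, n⟩ - he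
    have hp' : [i, j, k].Nodup := by simpa using hp
    obtain ⟨g, rfl, rfl, rfl⟩ := exists_perm_extending_three hp'
    obtain ⟨l, rfl⟩ := g.surjective l
    obtain ⟨m, rfl⟩ := g.surjective m
    obtain ⟨n, rfl⟩ := g.surjective n
    simp only [flippedFacet_apply] at he
    have key : ∀ l m n, flippedFacet 0 1 2 = flippedFacet l m n → l = 0 ∧ m = 1 ∧ n = 2 := by
      decide +kernel
    obtain ⟨rfl, rfl, rfl⟩ := key l m n (relabel_injective g he)
    rfl

theorem relabel_image_antipode (g : Equiv.Perm (Fin 6)) (s : Finset Label) :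
    relabel g (s.image antipode) = (relabel g s).image antipode := by
  simp only [relabel, Finset.image_image]
  exact Finset.image_congr fun S _ => permLabel_compl g S

theorem image_antipode_antipode (s : Finset Label) : (s.image antipode).image antipode = s := by
  rw [Finset.image_image, antipode_involutive.comp_self, Finset.image_id]

/-- The antipode commutes with permutations, so it carries orbits to orbits and one representative
decides which. Below, `(0 4)(1 5)` matches the chosen representatives, exchanging types one and two,
and types three and four. -/
theorem image_antipode_orbits {r r' : Finset Label}
    (h : ∃ i j k l : Fin 6, r' = relabel (Equiv.swap i j * Equiv.swap k l) (r.image antipode)) :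
    (fun F => F.image antipode) '' orbits {r} = orbits {r'} := by
  obtain ⟨i, j, k, l, rfl⟩ := h
  ext s
  constructor
  · rintro ⟨_, ⟨g, _, rfl, rfl⟩, rfl⟩
    refine ⟨g * (Equiv.swap i j * Equiv.swap k l)⁻¹, _, rfl, ?_⟩
    rw [relabel_mul, relabel_inv_relabel, relabel_image_antipode]
  · rintro ⟨g, _, rfl, rfl⟩
    refine ⟨_, ⟨g * (Equiv.swap i j * Equiv.swap k l), _, rfl, rfl⟩, ?_⟩
    change (relabel _ r).image antipode = _
    rw [← relabel_image_antipode, relabel_mul]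

theorem image_antipode_orbits_repStar :
    (fun F => F.image antipode) '' orbits {repStar} = orbits {repMiddle} :=
  image_antipode_orbits ⟨0, 4, 1, 5, by decide +kernel⟩

theorem image_antipode_orbits_repFlipped :
    (fun F => F.image antipode) '' orbits {repFlipped} = orbits {repVertex} :=
  image_antipode_orbits ⟨0, 4, 1, 5, by decide +kernel⟩

theorem image_antipode_injective : Injective fun F : Finset Label => F.image antipode :=
  Finset.image_injective antipode_involutive.injective

theorem ncard_orbits_repMiddle : (orbits {repMiddle}).ncard = 30 := by
  rw [← image_antipode_orbits_repStar, Set.ncard_image_of_injective _ image_antipode_injective,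
    ncard_orbits_repStar]

theorem ncard_orbits_repVertex : (orbits {repVertex}).ncard = 120 := by
  rw [← image_antipode_orbits_repFlipped, Set.ncard_image_of_injective _ image_antipode_injective,
    ncard_orbits_repFlipped]

theorem ncard_facets432 : facets432.ncard = 300 := by
  rw [facets432_eq, Set.ncard_union_eq, Set.ncard_union_eq, Set.ncard_union_eq,
    ncard_orbits_repStar, ncard_orbits_repMiddle, ncard_orbits_repFlipped, ncard_orbits_repVertex]
  · exact disjoint_orbits (by decide)
  · exact (disjoint_orbits (by decide)).union_left (disjoint_orbits (by decide))
  · exact ((disjoint_orbits (by decide)).union_left (disjoint_orbits (by decide))).union_left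
      (disjoint_orbits (by decide))

theorem image_antipode_facets432 : (fun F => F.image antipode) '' facets432 = facets432 := by
  have h1 := image_antipode_orbits_repStar
  have h2 := image_antipode_orbits_repFlipped
  have h3 : (fun F => F.image antipode) '' orbits {repMiddle} = orbits {repStar} := by
    rw [← h1, Set.image_image]
    simp [image_antipode_antipode]
  have h4 : (fun F => F.image antipode) '' orbits {repVertex} = orbits {repFlipped} := by
    rw [← h2, Set.image_image]
    simp [image_antipode_antipode]
  rw [facets432_eq, Set.image_union, Set.image_union, Set.image_union, h1, h2, h3, h4]
  ext s
  simp only [Set.mem_union]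
  tauto

theorem map_antipode_S432 : S432.map antipode = S432 := by
  rw [S432_eq, map_generatedBy]
  exact congrArg generatedBy image_antipode_facets432

/-- A necessary condition for two labels to lie in a common facet of `S432`. -/
def Near (S T : Label) : Prop :=
  (S.card = 1 ∨ S.card = 3 ∨ S.card = 5) ∧
    (S.card ≤ (S ∩ T).card ∨ T.card ≤ (S ∩ T).card ∨ S.card = 3 ∧ T.card = 3 ∧ 2 ≤ (S ∩ T).card)

instance (S T : Label) : Decidable (Near S T) := inferInstanceAs (Decidable (_ ∧ _))

theorem near_permLabel {g : Equiv.Perm (Fin 6)} {S T : Label} :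
    Near (permLabel g S) (permLabel g T) ↔ Near S T := by
  have : permLabel g S ∩ permLabel g T = permLabel g (S ∩ T) := (Finset.map_inter _ _).symm
  rw [Near, this, card_permLabel, card_permLabel, card_permLabel, Near]

/-- `Near` is invariant under permutations, so it only has to be checked inside the four
representatives. -/
theorem near_of_mem_face {s : Finset Label} (hs : s ∈ S432.faces) {S T : Label} (hS : S ∈ s)
    (hT : T ∈ s) : Near S T := by
  rw [S432_eq] at hs
  obtain ⟨-, _, ⟨g, r, hr, rfl⟩, hsr⟩ := hs
  obtain ⟨S, rfl⟩ := exists_permLabel_eq g S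
  obtain ⟨T, rfl⟩ := exists_permLabel_eq g T
  rw [near_permLabel]
  replace hS := permLabel_mem_relabel.1 (hsr hS)
  replace hT := permLabel_mem_relabel.1 (hsr hT)
  revert S T r
  simp only [Set.mem_insert_iff, Set.mem_singleton_iff]
  have : ∀ r, r = repStar ∨ r = repMiddle ∨ r = repFlipped ∨ r = repVertex →
      ∀ S ∈ r, ∀ T ∈ r, Near S T := by
    simp only [forall_eq_or_imp, forall_eq]
    decide +kernel
  exact fun r hr _ S T hS hT => this r hr S hS T hT

/-- Two labels in a common face are nested or are triples sharing two indices. If `T` were so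
related both to `S` and to its complement, one of the sets would be empty or full, or two triples
would share at least two indices both with each other and with the complement; the cardinalities
exclude this. -/
theorem not_near_of_near {S T : Label} : Near S T → ¬ Near T Sᶜ := by
  have : ∀ S T : Label, Near S T → ¬ Near T Sᶜ := by decide +kernel
  exact this S T

/-- Adjacent vertices are `Near`, so `not_near_of_near` excludes a walk of length 2. Since `Near S
S` holds, it also excludes lengths 0 and 1. -/
theorem isAntipodal_S432 : IsAntipodal S432 antipode where
  involutive := antipode_involutive
  invariant := map_antipode_S432
  three_le_edist := by
    intro S hS
    have hSS : Near S S := near_of_mem_face hS (Finset.mem_singleton_self S)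
      (Finset.mem_singleton_self S)
    by_contra hlt
    rw [not_le] at hlt
    obtain ⟨p, hp⟩ := SimpleGraph.exists_walk_of_edist_ne_top hlt.ne_top
    rw [← hp] at hlt
    have hl : p.length < 3 := by exact_mod_cast hlt
    have hadj : ∀ {T U : Label}, (skeletonGraph S432).Adj T U → Near T U := fun h =>
      near_of_mem_face h.2 (by simp) (by simp)
    have hfar : ∀ {T : Label}, Near S T → ¬ Near T (antipode S) := not_near_of_near
    have hfar' : ¬ Near S (antipode S) := hfar hSS
    clear hp hlt
    generalize antipode S = T at p hfar hfar'
    cases p with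
    | nil => exact hfar' hSS
    | cons h p =>
      cases p with
      | nil => exact hfar' (hadj h)
      | cons h' p =>
        cases p with
        | nil => exact hfar (hadj h) (hadj h')
        | cons h'' p =>
          simp only [SimpleGraph.Walk.length_cons] at hl
          omega

end Facets

/-! ### The quotient of `S432` by the antipodal map -/

section Quotient

theorem toQuotient_eq_iff {S T : Label} : toQuotient S = toQuotient T ↔ T = S ∨ T = antipode S :=
  Quotient.eq (r := involutionSetoid antipode antipode_involutive)

theorem toQuotient_antipode (S : Label) : toQuotient (antipode S) = toQuotient S :=
  (toQuotient_eq_iff.2 (Or.inr rfl)).symm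

theorem image_toQuotient_antipode (s : Finset Label) :
    (s.image antipode).image toQuotient = s.image toQuotient := by
  rw [Finset.image_image]
  exact Finset.image_congr fun S _ => toQuotient_antipode S

theorem antipode_notMem_of_mem {s : Finset Label} (hs : s ∈ S432.faces) {S T : Label} (hS : S ∈ s)
    (hST : Near T S) : antipode T ∉ s := fun hT =>
  not_near_of_near hST (near_of_mem_face hs hS hT)

theorem toQuotient_injOn {s : Finset Label} (hs : s ∈ S432.faces) :
    Set.InjOn toQuotient (s : Set Label) := by
  intro S hS T hT h
  rcases toQuotient_eq_iff.1 h with h | h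
  · exact h.symm
  · exact absurd (h ▸ hT) (antipode_notMem_of_mem hs hS (near_of_mem_face hs hS hS))

/-- Over each vertex of the image, `t` contains the label of `s` or its antipode. If `s` and `t`
share one label, separation forbids the antipode of any other label of `s` in `t`, so there is no
mixed case. -/
theorem eq_or_eq_image_antipode {s t : Finset Label} (hs : s ∈ S432.faces) (ht : t ∈ S432.faces)
    (h : s.image toQuotient = t.image toQuotient) : t = s ∨ t = s.image antipode := by
  have hst : ∀ S ∈ s, S ∈ t ∨ antipode S ∈ t := fun S hS => by
    obtain ⟨T, hT, he⟩ := Finset.mem_image.1 (h ▸ Finset.mem_image_of_mem toQuotient hS)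
    rcases toQuotient_eq_iff.1 he.symm with rfl | rfl
    · exact Or.inl hT
    · exact Or.inr hT
  have hts : ∀ T ∈ t, T ∈ s ∨ antipode T ∈ s := fun T hT => by
    obtain ⟨S, hS, he⟩ := Finset.mem_image.1 (h ▸ Finset.mem_image_of_mem toQuotient hT)
    rcases toQuotient_eq_iff.1 he.symm with rfl | rfl
    · exact Or.inl hS
    · exact Or.inr hS
  by_cases hcom : ∃ S ∈ s, S ∈ t
  · left
    obtain ⟨S, hS, hSt⟩ := hcom
    have hsub : s ⊆ t := fun T hT => (hst T hT).resolve_right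
      (antipode_notMem_of_mem ht hSt (near_of_mem_face hs hT hS))
    refine Finset.Subset.antisymm (fun T hT => (hts T hT).resolve_right fun hT' => ?_) hsub
    exact antipode_notMem_of_mem ht hT (near_of_mem_face ht hT hT) (hsub hT')
  · right
    push Not at hcom
    ext T
    rw [Finset.mem_image]
    constructor
    · intro hT
      exact ⟨antipode T, (hts T hT).resolve_left fun h => hcom T h hT, antipode_involutive T⟩
    · rintro ⟨S, hS, rfl⟩
      exact (hst S hS).resolve_left (hcom S hS)

theorem mem_faces_of_mem_facets432 {F : Finset Label} (hF : F ∈ facets432) : F ∈ S432.faces := by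
  rw [← facets_S432] at hF
  exact hF.1

/-- The map induced by the quotient map on sets of labels. -/
def faceToQuotient (s : Finset Label) : Finset QuotientLabel := s.image toQuotient

theorem quotientS432_eq : quotientS432 = generatedBy (faceToQuotient '' facets432) := by
  rw [quotientS432, S432_eq, map_generatedBy]
  rfl

theorem card_faceToQuotient {F : Finset Label} (hF : F ∈ facets432) :
    (faceToQuotient F).card = 5 := by
  rw [faceToQuotient, Finset.card_image_of_injOn (toQuotient_injOn (mem_faces_of_mem_facets432 hF)),
    card_of_mem_facets432 F hF]

theorem facets_quotientS432 : facets quotientS432 = faceToQuotient '' facets432 := by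
  rw [quotientS432_eq]
  refine facets_generatedBy (n := 5) (by norm_num) ?_
  rintro _ ⟨F, hF, rfl⟩
  exact card_faceToQuotient hF

theorem orbits_repStar_subset : orbits {repStar} ⊆ facets432 := by
  rw [facets432_eq]
  exact fun s hs => Or.inl (Or.inl (Or.inl hs))

theorem orbits_repFlipped_subset : orbits {repFlipped} ⊆ facets432 := by
  rw [facets432_eq]
  exact fun s hs => Or.inl (Or.inr hs)

theorem faceToQuotient_image_repMiddle :
    faceToQuotient '' orbits {repMiddle} = faceToQuotient '' orbits {repStar} := by
  rw [← image_antipode_orbits_repStar, Set.image_image]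
  exact Set.image_congr fun s _ => image_toQuotient_antipode s

theorem faceToQuotient_image_repVertex :
    faceToQuotient '' orbits {repVertex} = faceToQuotient '' orbits {repFlipped} := by
  rw [← image_antipode_orbits_repFlipped, Set.image_image]
  exact Set.image_congr fun s _ => image_toQuotient_antipode s

theorem facets_quotientS432_eq_union : facets quotientS432 =
    faceToQuotient '' orbits {repStar} ∪ faceToQuotient '' orbits {repFlipped} := by
  rw [facets_quotientS432, facets432_eq, Set.image_union, Set.image_union, Set.image_union,
    faceToQuotient_image_repMiddle, faceToQuotient_image_repVertex, Set.union_self, Set.union_assoc,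
    Set.union_self]

theorem faceToQuotient_injOn {X : Set (Finset Label)} (hX : X ⊆ facets432)
    (h : ∀ s ∈ X, s.image antipode ∉ X) : Set.InjOn faceToQuotient X := by
  intro s hs t ht hst
  rcases eq_or_eq_image_antipode (mem_faces_of_mem_facets432 (hX hs))
    (mem_faces_of_mem_facets432 (hX ht)) hst with h' | h'
  · exact h'.symm
  · exact absurd (h' ▸ ht) (h s hs)

/-- The antipode sends types one and three to types two and four, so together they contain one facet
from each antipodal pair. -/
theorem faceToQuotient_injOn_union :
    Set.InjOn faceToQuotient (orbits {repStar} ∪ orbits {repFlipped}) := by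
  have e1 : degreeCubes repStar = 193 := by decide
  have e2 : degreeCubes repMiddle = 257 := by decide
  have e3 : degreeCubes repFlipped = 213 := by decide
  have e4 : degreeCubes repVertex = 207 := by decide
  refine faceToQuotient_injOn (Set.union_subset orbits_repStar_subset orbits_repFlipped_subset) ?_
  have key : ∀ s ∈ orbits {repStar} ∪ orbits {repFlipped}, degreeCubes s = 193 ∨ degreeCubes s = 213 := by
    rintro s (hs | hs)
    · exact Or.inl ((degreeCubes_of_mem_orbits hs).trans e1)
    · exact Or.inr ((degreeCubes_of_mem_orbits hs).trans e3)
  rintro s (hs | hs) hs'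
  · have hm := degreeCubes_of_mem_orbits
      (image_antipode_orbits_repStar ▸ Set.mem_image_of_mem (fun F : Finset Label => F.image antipode) hs)
    have := key _ hs'
    omega
  · have hm := degreeCubes_of_mem_orbits
      (image_antipode_orbits_repFlipped ▸ Set.mem_image_of_mem (fun F : Finset Label => F.image antipode) hs)
    have := key _ hs'
    omega

theorem ncard_faceToQuotient_repStar : (faceToQuotient '' orbits {repStar}).ncard = 30 := by
  rw [(faceToQuotient_injOn_union.mono Set.subset_union_left).ncard_image, ncard_orbits_repStar]

theorem ncard_faceToQuotient_repFlipped : (faceToQuotient '' orbits {repFlipped}).ncard = 120 := by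
  rw [(faceToQuotient_injOn_union.mono Set.subset_union_right).ncard_image,
    ncard_orbits_repFlipped]

theorem ncard_facets_quotientS432 : (facets quotientS432).ncard = 150 := by
  rw [facets_quotientS432_eq_union, ← Set.image_union, faceToQuotient_injOn_union.ncard_image,
    Set.ncard_union_eq (disjoint_orbits (by decide)), ncard_orbits_repStar, ncard_orbits_repFlipped]

theorem vertices_quotientS432 : vertices quotientS432 =
    toQuotient '' (verticesOfCard 1 ∪ verticesOfCard 3 ∪ verticesOfCard 5) := by
  rw [← vertices_S432]
  ext Q
  constructor
  · rintro ⟨s, hs, he⟩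
    have hQ : Q ∈ s.image toQuotient := by
      have he' : s.image toQuotient = {Q} := he
      rw [he']
      exact Finset.mem_singleton_self Q
    obtain ⟨S, hS, rfl⟩ := Finset.mem_image.1 hQ
    refine ⟨S, ?_, rfl⟩
    exact (S432.isRelLowerSet_faces hs).2 (Finset.singleton_subset_iff.2 hS)
      (Finset.singleton_nonempty S)
  · rintro ⟨S, hS, rfl⟩
    exact ⟨{S}, hS, Finset.image_singleton _ _⟩

theorem toQuotient_image_coe (P : Label → Prop) [DecidablePred P] :
    toQuotient '' {S | P S} = ((Finset.univ.filter P).image toQuotient : Finset QuotientLabel) := by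
  simp

theorem ncard_vertices_quotientS432 : (vertices quotientS432).ncard = 16 := by
  have : (verticesOfCard 1 ∪ verticesOfCard 3 ∪ verticesOfCard 5) =
      {S | (S.card = 1 ∨ S.card = 3) ∨ S.card = 5} := rfl
  rw [vertices_quotientS432, this, toQuotient_image_coe, Set.ncard_coe_finset]
  decide +kernel

theorem ncard_toQuotient_verticesOfCard_one_five :
    (toQuotient '' (verticesOfCard 1 ∪ verticesOfCard 5)).ncard = 6 := by
  have : (verticesOfCard 1 ∪ verticesOfCard 5) = {S | S.card = 1 ∨ S.card = 5} := rfl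
  rw [this, toQuotient_image_coe, Set.ncard_coe_finset]
  decide +kernel

theorem ncard_toQuotient_verticesOfCard_three :
    (toQuotient '' verticesOfCard 3).ncard = 10 := by
  have : verticesOfCard 3 = {S | S.card = 3} := rfl
  rw [this, toQuotient_image_coe, Set.ncard_coe_finset]
  decide +kernel

end Quotient

/-! ### The quotient is a projective space -/

section Projective

/-- The map of realizations induced by the quotient map. -/
def pushforward (x : Label → ℝ) (Q : QuotientLabel) : ℝ := ∑ S, if toQuotient S = Q then x S else 0

/-- A face contains at most one label of each antipodal pair, so nothing is added up on it. -/
theorem pushforward_toQuotient {x : Label → ℝ} {s : Finset Label} (hs : s ∈ S432.faces)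
    (hx : ∀ S, S ∉ s → x S = 0) {S : Label} (hS : S ∈ s) :
    pushforward x (toQuotient S) = x S := by
  rw [pushforward, Finset.sum_eq_single S]
  · rw [if_pos rfl]
  · intro T _ hTS
    by_cases hT : T ∈ s
    · rw [if_neg fun h => hTS (toQuotient_injOn hs hT hS h)]
    · rw [hx T hT, ite_self]
  · simp

theorem pushforward_comp_antipode (x : Label → ℝ) : pushforward (x ∘ antipode) = pushforward x := by
  funext Q
  rw [pushforward, pushforward, ← Equiv.sum_comp antipode_involutive.toPerm]
  exact Finset.sum_congr rfl fun S _ => by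
    simp only [Involutive.coe_toPerm, comp_apply, toQuotient_antipode, antipode_involutive S]

theorem pushforward_eq_zero {x : Label → ℝ} {s : Finset Label} (hx : ∀ S, S ∉ s → x S = 0)
    {Q : QuotientLabel} (hQ : Q ∉ s.image toQuotient) : pushforward x Q = 0 := by
  refine Finset.sum_eq_zero fun S _ => ?_
  split_ifs with h
  · exact hx S fun hS => hQ (h ▸ Finset.mem_image_of_mem _ hS)
  · rfl

theorem sum_pushforward (x : Label → ℝ) : ∑ Q, pushforward x Q = ∑ S, x S := by
  simp only [pushforward]
  rw [Finset.sum_comm]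
  simp

/-- The facets of the quotient. -/
def quotientFacets : Set (Finset QuotientLabel) := faceToQuotient '' facets432

theorem pushforward_mem {x : Label → ℝ} (hx : x ∈ realization (generatedBy facets432)) :
    pushforward x ∈ realization (generatedBy quotientFacets) := by
  obtain ⟨h0, h1, F, hF, hxF⟩ := mem_realization_generatedBy.1 hx
  refine mem_realization_generatedBy.2 ⟨fun Q => Finset.sum_nonneg fun S _ => ?_, ?_, _,
    ⟨F, hF, rfl⟩, fun Q hQ => pushforward_eq_zero hxF hQ⟩
  · split_ifs
    · exact h0 S
    · exact le_rfl
  · rw [sum_pushforward, h1]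

theorem exists_pushforward_eq {y : QuotientLabel → ℝ}
    (hy : y ∈ realization (generatedBy quotientFacets)) :
    ∃ x ∈ realization (generatedBy facets432), pushforward x = y := by
  obtain ⟨h0, h1, _, ⟨F, hF, rfl⟩, hyF⟩ := mem_realization_generatedBy.1 hy
  -- Barycentric coordinates are lifted to one of the two facets above the given facet.
  let x : Label → ℝ := fun S => if S ∈ F then y (toQuotient S) else 0
  have hxF : ∀ S, S ∉ F → x S = 0 := fun S hS => if_neg hS
  have hxy : pushforward x = y := by
    funext Q
    by_cases hQ : Q ∈ faceToQuotient F
    · obtain ⟨S, hS, rfl⟩ := Finset.mem_image.1 hQ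
      rw [pushforward_toQuotient (mem_faces_of_mem_facets432 hF) hxF hS]
      exact if_pos hS
    · rw [hyF Q hQ, pushforward_eq_zero hxF hQ]
  refine ⟨x, mem_realization_generatedBy.2 ⟨fun S => ?_, ?_, F, hF, hxF⟩, hxy⟩
  · simp only [x]
    split_ifs
    · exact h0 _
    · exact le_rfl
  · rw [← sum_pushforward, hxy, h1]

/-- The set of labels with nonzero coordinate. -/
noncomputable def coordSupport (x : Label → ℝ) : Finset Label :=
  Set.Finite.toFinset (Set.toFinite (support x))

theorem mem_coordSupport {x : Label → ℝ} {S : Label} : S ∈ coordSupport x ↔ x S ≠ 0 := by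
  simp [coordSupport]

theorem eq_zero_of_notMem_coordSupport {x : Label → ℝ} {S : Label} (h : S ∉ coordSupport x) :
    x S = 0 := by
  rwa [mem_coordSupport, not_not] at h

theorem coordSupport_mem_faces {x : Label → ℝ} (hx : x ∈ realization (generatedBy facets432)) :
    coordSupport x ∈ S432.faces := by
  obtain ⟨-, h1, F, hF, hxF⟩ := mem_realization_generatedBy.1 hx
  rw [S432_eq]
  refine ⟨?_, F, hF, fun S hS => ?_⟩
  · by_contra hne
    rw [Finset.not_nonempty_iff_eq_empty] at hne
    have : ∀ S, x S = 0 := fun S => eq_zero_of_notMem_coordSupport (by simp [hne])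
    simp [this] at h1
  · by_contra h
    exact mem_coordSupport.1 hS (hxF S h)

theorem mem_image_coordSupport {x : Label → ℝ} (hx : x ∈ realization (generatedBy facets432))
    {Q : QuotientLabel} : Q ∈ (coordSupport x).image toQuotient ↔ pushforward x Q ≠ 0 := by
  constructor
  · intro h
    obtain ⟨S, hS, rfl⟩ := Finset.mem_image.1 h
    rw [pushforward_toQuotient (coordSupport_mem_faces hx)
      (fun T => eq_zero_of_notMem_coordSupport) hS]
    exact mem_coordSupport.1 hS
  · intro h
    by_contra hQ
    exact h (pushforward_eq_zero (fun T => eq_zero_of_notMem_coordSupport) hQ)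

theorem eq_of_coordSupport_eq {x y : Label → ℝ} (hx : x ∈ realization (generatedBy facets432))
    (hs : coordSupport y = coordSupport x) (h : pushforward x = pushforward y) : y = x := by
  funext S
  by_cases hS : S ∈ coordSupport x
  · rw [← pushforward_toQuotient (coordSupport_mem_faces hx)
      (fun T => eq_zero_of_notMem_coordSupport) hS, h, pushforward_toQuotient
      (coordSupport_mem_faces hx) (fun T hT => eq_zero_of_notMem_coordSupport (hs ▸ hT)) hS]
  · rw [eq_zero_of_notMem_coordSupport hS]
    rw [← hs] at hS
    exact eq_zero_of_notMem_coordSupport hS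

theorem comp_antipode_mem {x : Label → ℝ} (hx : x ∈ realization (generatedBy facets432)) :
    x ∘ antipode ∈ realization (generatedBy facets432) := by
  obtain ⟨h0, h1, F, hF, hxF⟩ := mem_realization_generatedBy.1 hx
  refine mem_realization_generatedBy.2 ⟨fun S => h0 _, ?_, F.image antipode,
    image_antipode_facets432 ▸ Set.mem_image_of_mem (fun F => F.image antipode) hF, fun S hS => ?_⟩
  · rw [← h1, ← Equiv.sum_comp antipode_involutive.toPerm]
    rfl
  · refine hxF _ fun h => hS (Finset.mem_image.2 ⟨_, h, antipode_involutive S⟩)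

/-- The support of the image determines the support upstairs up to the antipode, and on a given
support the coordinates can be read off from the image. -/
theorem pushforward_eq_iff {x y : Label → ℝ} (hx : x ∈ realization (generatedBy facets432))
    (hy : y ∈ realization (generatedBy facets432)) :
    pushforward x = pushforward y ↔ y = x ∨ y = x ∘ antipode := by
  constructor
  · intro h
    have hs : (coordSupport x).image toQuotient = (coordSupport y).image toQuotient := by
      ext Q
      rw [mem_image_coordSupport hx, mem_image_coordSupport hy, h]
    rcases eq_or_eq_image_antipode (coordSupport_mem_faces hx) (coordSupport_mem_faces hy) hs
      with hs | hs
    · exact Or.inl (eq_of_coordSupport_eq hx hs h)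
    · refine Or.inr (eq_of_coordSupport_eq (comp_antipode_mem hx) ?_
        ((pushforward_comp_antipode x).trans h))
      rw [hs]
      ext S
      rw [mem_coordSupport, Finset.mem_image]
      constructor
      · rintro ⟨T, hT, rfl⟩
        rw [comp_apply, antipode_involutive T]
        exact mem_coordSupport.1 hT
      · intro h
        exact ⟨antipode S, mem_coordSupport.2 h, antipode_involutive S⟩
  · rintro (rfl | rfl)
    · rfl
    · exact (pushforward_comp_antipode x).symm

/-- Complementary indicators add up to 1, which is zero modulo the diagonal, and the weights for
cardinalities 1 and 5 agree. -/
theorem weightedPoint_antipode (S : Label) :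
    weightedPoint (weight 4 3 4) (antipode S) = -weightedPoint (weight 4 3 4) S := by
  have h1 : indicator (antipode S) = 1 - indicator S := by
    funext i
    by_cases h : i ∈ S <;> simp [indicator, antipode, h]
  have h2 : ∀ S : Label, weight 4 3 4 (antipode S).card = weight 4 3 4 S.card := by
    decide +kernel
  rw [weightedPoint, weightedPoint, h1, h2, map_sub, modDiagonal_one, zero_sub, smul_neg]

/-- The converse direction follows from the injectivity of the radial projection. -/
theorem toSphere_comp_antipode {x y : realization (generatedBy facets432)} :
    y.1 = x.1 ∘ antipode ↔ isPolytopal_S432.toSphere y = -isPolytopal_S432.toSphere x := by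
  constructor
  · exact isPolytopal_S432.toSphere_comp antipode_involutive weightedPoint_antipode
  · intro h
    have := isPolytopal_S432.toSphere_comp antipode_involutive weightedPoint_antipode
      (x := x) (y := ⟨_, comp_antipode_mem x.2⟩) rfl
    rw [← h] at this
    exact (congrArg Subtype.val (isPolytopal_S432.toSphere_bijective.1 this)).symm

theorem continuous_pushforward : Continuous pushforward := by
  refine continuous_pi fun Q => continuous_finsetSum _ fun S _ => ?_
  split_ifs
  · exact continuous_apply S
  · exact continuous_const

/-- The map from the sphere to the realization of the quotient complex. -/
noncomputable def sphereToQuotient (a : Sphere4) : realization (generatedBy quotientFacets) :=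
  ⟨pushforward (isPolytopal_S432.homeomorphSphere.symm a).1,
    pushforward_mem (isPolytopal_S432.homeomorphSphere.symm a).2⟩

theorem continuous_sphereToQuotient : Continuous sphereToQuotient :=
  (continuous_pushforward.comp
    (continuous_subtype_val.comp isPolytopal_S432.homeomorphSphere.symm.continuous)).subtype_mk _

theorem sphereToQuotient_surjective : Surjective sphereToQuotient := by
  rintro ⟨y, hy⟩
  obtain ⟨x, hx, rfl⟩ := exists_pushforward_eq hy
  refine ⟨isPolytopal_S432.homeomorphSphere ⟨x, hx⟩, Subtype.ext ?_⟩
  simp only [sphereToQuotient, Homeomorph.symm_apply_apply]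

theorem sphereToQuotient_eq_iff {a b : Sphere4} :
    sphereToQuotient a = sphereToQuotient b ↔ b = a ∨ b = -a := by
  obtain ⟨x, rfl⟩ := isPolytopal_S432.homeomorphSphere.surjective a
  obtain ⟨y, rfl⟩ := isPolytopal_S432.homeomorphSphere.surjective b
  rw [Subtype.ext_iff]
  simp only [sphereToQuotient, Homeomorph.symm_apply_apply, EmbeddingLike.apply_eq_iff_eq]
  exact (pushforward_eq_iff x.2 y.2).trans (or_congr Subtype.ext_iff.symm toSphere_comp_antipode)

/-- A continuous surjection from a compact space to a Hausdorff space is a quotient map, and its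
fibres here are the antipodal pairs of the sphere. -/
theorem nonempty_homeomorph_realProjective4 :
    Nonempty (realization quotientS432 ≃ₜ RealProjective4) := by
  rw [quotientS432_eq]
  have hq : Topology.IsQuotientMap sphereToQuotient :=
    continuous_sphereToQuotient.isClosedMap.isQuotientMap continuous_sphereToQuotient
      sphereToQuotient_surjective
  have hker : Setoid.ker sphereToQuotient =
      involutionSetoid (fun x : Sphere4 => -x) neg_involutive :=
    Setoid.ext fun a b => sphereToQuotient_eq_iff
  let f : C(Sphere4, realization (generatedBy quotientFacets)) := ⟨_, continuous_sphereToQuotient⟩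
  have hf : Topology.IsQuotientMap f := hq
  have e : Nonempty (Quotient (Setoid.ker sphereToQuotient) ≃ₜ
      realization (generatedBy quotientFacets)) := ⟨hf.homeomorph⟩
  rw [hker] at e
  exact e.map Homeomorph.symm

end Projective

/-! ### The action of the permutations on the quotient -/

section Action

open Equiv

/-- The action of the permutations of the coordinates on the labels of the quotient. -/
def quotientAction : Perm (Fin 6) →* Perm QuotientLabel :=
  MonoidHom.toHomPerm
    { toFun := fun g => Quotient.map (permLabel g) (by
        rintro S T (rfl | rfl)
        · exact Or.inl rfl
        · exact Or.inr (permLabel_compl g S))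
      map_one' := by
        funext Q
        induction Q using Quotient.inductionOn with
        | h S => exact congrArg toQuotient (permLabel_one S)
      map_mul' := fun g h => by
        funext Q
        induction Q using Quotient.inductionOn with
        | h S => exact congrArg toQuotient (permLabel_mul g h S) }

theorem quotientAction_toQuotient (g : Perm (Fin 6)) (S : Label) :
    quotientAction g (toQuotient S) = toQuotient (permLabel g S) := rfl

theorem map_quotientAction (g : Perm (Fin 6)) :
    quotientS432.map (quotientAction g) = quotientS432 := by
  have h : quotientAction g ∘ toQuotient = toQuotient ∘ permLabel g := rfl
  rw [quotientS432, map_map, h, ← map_map, map_permLabel_S432]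

/-- The vertices over `V₁` suffice: a singleton is never the antipode of a singleton, so fixing the
class of `{i}` means fixing `i`. -/
theorem quotientAction_faithful (g : Perm (Fin 6))
    (h : ∀ v ∈ vertices quotientS432, quotientAction g v = v) : g = 1 := by
  ext i
  have hi := h (toQuotient {i}) (by
    rw [vertices_quotientS432]
    exact ⟨{i}, Or.inl (Or.inl (Finset.card_singleton i)), rfl⟩)
  rw [quotientAction_toQuotient, permLabel_singleton, toQuotient_eq_iff] at hi
  rcases hi with hi | hi
  · rw [Finset.singleton_inj] at hi
    rw [← hi]
    rfl
  · have := congrArg Finset.card hi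
    rw [antipode, Finset.card_compl, Finset.card_singleton, Finset.card_singleton] at this
    simp at this

theorem range_quotientAction (S : Label) :
    (Set.range fun g => quotientAction g (toQuotient S)) = toQuotient '' verticesOfCard S.card := by
  ext Q
  constructor
  · rintro ⟨g, rfl⟩
    exact ⟨permLabel g S, card_permLabel g S, rfl⟩
  · rintro ⟨T, hT, rfl⟩
    obtain ⟨g, rfl⟩ := Perm.exists_map_finset_eq S T hT.symm
    exact ⟨g, rfl⟩

theorem toQuotient_verticesOfCard_five :
    toQuotient '' verticesOfCard 5 = toQuotient '' verticesOfCard 1 := by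
  have h : ∀ {m n : ℕ}, m + n = 6 →
      toQuotient '' verticesOfCard m ⊆ toQuotient '' verticesOfCard n := by
    rintro m n hmn _ ⟨S, hS, rfl⟩
    refine ⟨antipode S, ?_, toQuotient_antipode S⟩
    change S.card = m at hS
    change Sᶜ.card = n
    rw [Finset.card_compl, Fintype.card_fin]
    omega
  exact (h rfl).antisymm (h rfl)

theorem vertexOrbits :
    {O | ∃ v ∈ vertices quotientS432, O = Set.range fun g => quotientAction g v} =
      {toQuotient '' (verticesOfCard 1 ∪ verticesOfCard 5), toQuotient '' verticesOfCard 3} := by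
  rw [Set.image_union, toQuotient_verticesOfCard_five, Set.union_self, vertices_quotientS432]
  ext O
  constructor
  · rintro ⟨_, ⟨S, (hS | hS) | hS, rfl⟩, rfl⟩
    all_goals rw [range_quotientAction, show S.card = _ from hS]
    · exact Or.inl rfl
    · exact Or.inr rfl
    · exact Or.inl toQuotient_verticesOfCard_five
  · have key : ∀ S : Label, S.card = 1 ∨ S.card = 3 → ∃ v ∈ toQuotient ''
        (verticesOfCard 1 ∪ verticesOfCard 3 ∪ verticesOfCard 5),
        toQuotient '' verticesOfCard S.card = Set.range fun g => quotientAction g v := fun S hS =>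
      ⟨_, ⟨S, Or.inl hS, rfl⟩, (range_quotientAction S).symm⟩
    rintro (rfl | rfl)
    · exact key {0} (by decide)
    · exact key {0, 1, 2} (by decide)

theorem map_quotientAction_faceToQuotient (g : Perm (Fin 6)) (s : Finset Label) :
    (faceToQuotient s).map (quotientAction g).toEmbedding = faceToQuotient (relabel g s) := by
  rw [Finset.map_eq_image, faceToQuotient, faceToQuotient, relabel, Finset.image_image,
    Finset.image_image]
  rfl

theorem range_map_quotientAction (g : Perm (Fin 6)) (r : Finset Label) :
    (Set.range fun h => (faceToQuotient (relabel g r)).map (quotientAction h).toEmbedding) =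
      faceToQuotient '' orbits {r} := by
  simp only [map_quotientAction_faceToQuotient]
  ext s
  constructor
  · rintro ⟨h, rfl⟩
    exact ⟨_, ⟨h * g, _, rfl, (relabel_mul h g r).symm⟩, rfl⟩
  · rintro ⟨_, ⟨h, _, rfl, rfl⟩, rfl⟩
    refine ⟨h * g⁻¹, ?_⟩
    simp only [relabel_mul, relabel_inv_relabel]

theorem facetOrbits :
    {O | ∃ s ∈ facets quotientS432,
      O = Set.range fun g => s.map (quotientAction g).toEmbedding} =
      {faceToQuotient '' orbits {repStar}, faceToQuotient '' orbits {repFlipped}} := by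
  rw [facets_quotientS432_eq_union]
  ext O
  constructor
  · rintro ⟨_, ⟨_, ⟨g, _, rfl, rfl⟩, rfl⟩ | ⟨_, ⟨g, _, rfl, rfl⟩, rfl⟩, rfl⟩
    · exact Or.inl (range_map_quotientAction g _)
    · exact Or.inr (range_map_quotientAction g _)
  · rintro (rfl | rfl)
    · exact ⟨_, Or.inl ⟨_, ⟨1, _, rfl, rfl⟩, rfl⟩, (range_map_quotientAction 1 _).symm⟩
    · exact ⟨_, Or.inr ⟨_, ⟨1, _, rfl, rfl⟩, rfl⟩, (range_map_quotientAction 1 _).symm⟩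

end Action

/-! ### The isomorphism with Lutz's complex -/

section Lutz

/-- The numbers of the labels that do not contain `5`, or contain only `5`. -/
def lutzNumberAux (S : Label) : ℕ :=
  -- One label is listed from each antipodal pair. All other labels get 0, so the maximum over a
  -- pair picks out the listed number.
  if S = {0} then 11 else if S = {1} then 12 else if S = {2} then 13 else if S = {3} then 14 else
  if S = {4} then 15 else if S = {5} then 16 else if S = {0, 1, 2} then 9 else
  if S = {0, 1, 3} then 1 else if S = {0, 1, 4} then 3 else if S = {2, 3, 4} then 8 else
  if S = {0, 2, 3} then 5 else if S = {0, 2, 4} then 7 else if S = {1, 3, 4} then 10 else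
  if S = {0, 3, 4} then 4 else if S = {1, 2, 4} then 2 else if S = {1, 2, 3} then 6 else 0

/-- The number in Lutz's complex of a label of `S432`. -/
def lutzNumber (S : Label) : ℕ := max (lutzNumberAux S) (lutzNumberAux Sᶜ)

/-- The number in Lutz's complex of a vertex of the quotient. -/
def quotientLutzNumber : QuotientLabel → ℕ :=
  Quotient.lift lutzNumber (by
    rintro S T (rfl | rfl)
    · rfl
    · simp only [lutzNumber, antipode, compl_compl]
      exact max_comm _ _)

theorem quotientLutzNumber_injOn : Set.InjOn quotientLutzNumber (vertices quotientS432) := by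
  rw [vertices_quotientS432]
  rintro _ ⟨S, hS, rfl⟩ _ ⟨T, hT, rfl⟩ h
  rw [toQuotient_eq_iff]
  have key : ∀ S T : Label, (S.card = 1 ∨ S.card = 3) ∨ S.card = 5 →
      (T.card = 1 ∨ T.card = 3) ∨ T.card = 5 → lutzNumber S = lutzNumber T →
      T = S ∨ T = antipode S := by
    decide +kernel
  exact key S T hS hT h

theorem image_quotientLutzNumber_faceToQuotient (s : Finset Label) :
    (faceToQuotient s).image quotientLutzNumber = s.image lutzNumber := by
  rw [faceToQuotient, Finset.image_image]
  rfl

theorem image_quotientLutzNumber_mem {s : Finset QuotientLabel} (hs : s ∈ facets quotientS432) :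
    s.image quotientLutzNumber ∈ lutzFacets := by
  rw [facets_quotientS432_eq_union, orbits_repStar, orbits_repFlipped] at hs
  rcases hs with ⟨_, ⟨i, j, h, rfl⟩, rfl⟩ | ⟨_, ⟨i, j, k, h, rfl⟩, rfl⟩
  · rw [image_quotientLutzNumber_faceToQuotient]
    revert i j
    decide +kernel
  · rw [image_quotientLutzNumber_faceToQuotient]
    revert i j k
    decide +kernel

theorem subset_vertices_of_mem_facets {V : Type*} {K : PreAbstractSimplicialComplex V}
    {s : Finset V} (hs : s ∈ facets K) : (s : Set V) ⊆ vertices K := fun v hv =>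
  (K.isRelLowerSet_faces hs.1).2 (Finset.singleton_subset_iff.2 hv) (Finset.singleton_nonempty v)

theorem injOn_image_of_injOn {V W : Type*} [DecidableEq W] {X : Set V} {f : V → W}
    (hf : Set.InjOn f X) {𝓢 : Set (Finset V)} (h : ∀ s ∈ 𝓢, (s : Set V) ⊆ X) :
    Set.InjOn (fun s : Finset V => s.image f) 𝓢 := by
  intro s hs t ht hst
  have hst' : f '' s = f '' t := by
    simpa only [Finset.coe_image] using congrArg (fun u : Finset W => (u : Set W)) hst
  exact Finset.coe_injective ((hf.image_eq_image_iff (h s hs) (h t ht)).1 hst')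

/-- One inclusion is checked by evaluation. Equality follows by counting: the 150 facets have
distinct images, and the list has at most 150 members. -/
theorem image_facets_quotientS432 :
    (fun s : Finset QuotientLabel => s.image quotientLutzNumber) '' facets quotientS432 =
      {s | s ∈ lutzFacets} := by
  have hcoe : {s | s ∈ lutzFacets} = (lutzFacets.toFinset : Set (Finset ℕ)) := by
    rw [List.coe_toFinset]
  refine Set.eq_of_subset_of_ncard_le ?_ ?_ (hcoe ▸ Finset.finite_toSet _)
  · rintro _ ⟨s, hs, rfl⟩
    exact image_quotientLutzNumber_mem hs
  · rw [(injOn_image_of_injOn quotientLutzNumber_injOn fun s hs =>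
      subset_vertices_of_mem_facets hs).ncard_image, ncard_facets_quotientS432, hcoe,
      Set.ncard_coe_finset]
    exact lutzFacets.toFinset_card_le

theorem isomorphic_lutzRP416 : Isomorphic quotientS432 lutzRP416 := by
  refine ⟨quotientLutzNumber, quotientLutzNumber_injOn, ?_⟩
  rw [lutzRP416, ← image_facets_quotientS432, facets_quotientS432, ← map_generatedBy,
    ← quotientS432_eq]

end Lutz

/-! ### Coordinates of the vertices and the two spheres -/

theorem point_singleton (i : Fin 6) : point {i} = Pi.single i 1 := by simp [point]

theorem point_triple {i j k : Fin 6} (h : [i, j, k].Nodup) :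
    point {i, j, k} = (1 / 3 : ℝ) • (Pi.single i 1 + Pi.single j 1 + Pi.single k 1) := by
  simp only [List.nodup_cons, List.mem_cons, List.not_mem_nil, not_or, or_false, not_false_eq_true]
    at h
  rw [point, Finset.card_eq_three.2 ⟨i, j, k, h.1.1, h.1.2, h.2.1, rfl⟩, Finset.sum_insert,
    Finset.sum_insert, Finset.sum_singleton]
  · norm_num [add_assoc]
  · simpa using h.2.1
  · simpa using h.1

theorem sum_single_eq_one : ∑ i : Fin 6, (Pi.single i 1 : Fin 6 → ℝ) = 1 := by
  ext j
  simp [Finset.sum_apply, Pi.single_apply]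

theorem point_antipode (S : Label) :
    point (antipode S) =
      ((6 - S.card : ℕ) : ℝ)⁻¹ • (1 - ∑ i ∈ S, (Pi.single i 1 : Fin 6 → ℝ)) := by
  rw [point, antipode, Finset.card_compl, Fintype.card_fin, ← sum_single_eq_one,
    ← Finset.sum_compl_add_sum S, add_sub_cancel_right]

theorem point_antipode_singleton (i : Fin 6) :
    point (antipode {i}) = (1 / 5 : ℝ) • (1 - Pi.single i 1) := by
  rw [point_antipode, Finset.card_singleton, Finset.sum_singleton]
  norm_num

theorem point_antipode_triple {i j k : Fin 6} (h : [i, j, k].Nodup) :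
    point (antipode {i, j, k}) =
      (1 / 3 : ℝ) • (1 - Pi.single i 1 - Pi.single j 1 - Pi.single k 1) := by
  simp only [List.nodup_cons, List.mem_cons, List.not_mem_nil, not_or, or_false, not_false_eq_true]
    at h
  rw [point_antipode, Finset.card_eq_three.2 ⟨i, j, k, h.1.1, h.1.2, h.2.1, rfl⟩,
    Finset.sum_insert, Finset.sum_insert, Finset.sum_singleton]
  · norm_num [sub_sub, add_assoc]
  · simpa using h.2.1
  · simpa using h.1

theorem nonempty_homeomorph_sphere4_X32 : Nonempty (realization X32 ≃ₜ Sphere4) := by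
  rw [X32_eq]
  exact ⟨isPolytopal_X32.homeomorphSphere⟩

theorem nonempty_homeomorph_sphere4_S432 : Nonempty (realization S432 ≃ₜ Sphere4) := by
  rw [S432_eq]
  exact ⟨isPolytopal_S432.homeomorphSphere⟩

end RP416

theorem mainTheorem1 :
    -- the antipodal map and the action of the permutations of the six coordinates, in coordinates
    ((∀ i, RP416.point {i} = Pi.single i 1) ∧
      (∀ i, RP416.point (RP416.antipode {i}) = (1 / 5 : ℝ) • (1 - Pi.single i 1)) ∧
      (∀ i j k, [i, j, k].Nodup →
        RP416.point {i, j, k} = (1 / 3 : ℝ) • (Pi.single i 1 + Pi.single j 1 + Pi.single k 1) ∧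
        RP416.point (RP416.antipode {i, j, k}) =
          (1 / 3 : ℝ) • (1 - Pi.single i 1 - Pi.single j 1 - Pi.single k 1)) ∧
      (∀ g S i, RP416.point (RP416.permLabel g S) (g i) = RP416.point S i)) ∧
    -- from the boundary of the 5-simplex to `X12`
    (RP416.vertices RP416.X6 = RP416.verticesOfCard 1 ∧
      RP416.TriangulatesByPoints RP416.X6 RP416.boundarySimplex ∧
      RP416.SimultaneousFlip RP416.X6 RP416.facetStarrings RP416.X12 ∧
      RP416.vertices RP416.X12 = RP416.verticesOfCard 1 ∪ RP416.verticesOfCard 5 ∧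
      RP416.TriangulatesByPoints RP416.X12 RP416.boundarySimplex ∧
      RP416.RefinesByPoints RP416.X12 RP416.X6) ∧
    -- the 32-vertex triangulated sphere `X32`
    (RP416.vertices RP416.X32 =
        RP416.verticesOfCard 1 ∪ RP416.verticesOfCard 3 ∪ RP416.verticesOfCard 5 ∧
      (RP416.vertices RP416.X32).ncard = 32 ∧
      RP416.TriangulatesByPoints RP416.X32 RP416.boundarySimplex ∧
      RP416.RefinesByPoints RP416.X32 RP416.X12 ∧
      Nonempty (RP416.realization RP416.X32 ≃ₜ RP416.Sphere4)) ∧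
    -- two rounds of simultaneous bistellar flips lead from `X32` to `S432`
    (∃ Y : PreAbstractSimplicialComplex RP416.Label,
      RP416.SimultaneousFlip RP416.X32 RP416.firstFlips Y ∧
      RP416.SimultaneousFlip Y RP416.secondFlips RP416.S432) ∧
    -- `S432` is a 4-sphere with the same 32 vertices, and its facets are of four types
    (RP416.vertices RP416.S432 = RP416.vertices RP416.X32 ∧
      Nonempty (RP416.realization RP416.S432 ≃ₜ RP416.Sphere4) ∧
      RP416.facets RP416.S432 =
        RP416.facetType1 ∪ RP416.facetType2 ∪ RP416.facetType3 ∪ RP416.facetType4 ∧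
      RP416.facetType1.ncard = 30 ∧ RP416.facetType2.ncard = 30 ∧
      RP416.facetType3.ncard = 120 ∧ RP416.facetType4.ncard = 120 ∧
      (RP416.facets RP416.S432).ncard = 300) ∧
    -- the antipodal map is a link-separating involution of `S432` and commutes with the action of
    -- the symmetric group on `S432`
    (RP416.IsAntipodal RP416.S432 RP416.antipode ∧
      (∀ g, RP416.S432.map (RP416.permLabel g) = RP416.S432) ∧
      (∀ g S, RP416.permLabel g (RP416.antipode S) = RP416.antipode (RP416.permLabel g S))) ∧
    -- the quotient is a triangulated real projective 4-space with 16 vertices and 150 facets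
    (Nonempty (RP416.realization RP416.quotientS432 ≃ₜ RP416.RealProjective4) ∧
      (RP416.vertices RP416.quotientS432).ncard = 16 ∧
      (RP416.facets RP416.quotientS432).ncard = 150 ∧
      (∀ s ∈ RP416.facets RP416.quotientS432, s.card = 5)) ∧
    -- the induced faithful action of the symmetric group on the quotient, with its orbits
    (∃ ρ : Equiv.Perm (Fin 6) →* Equiv.Perm RP416.QuotientLabel,
      (∀ g S, ρ g (RP416.toQuotient S) = RP416.toQuotient (RP416.permLabel g S)) ∧
      (∀ g, RP416.quotientS432.map (ρ g) = RP416.quotientS432) ∧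
      (∀ g, (∀ v ∈ RP416.vertices RP416.quotientS432, ρ g v = v) → g = 1) ∧
      {O | ∃ v ∈ RP416.vertices RP416.quotientS432, O = Set.range fun g => ρ g v} =
        {RP416.toQuotient '' (RP416.verticesOfCard 1 ∪ RP416.verticesOfCard 5),
          RP416.toQuotient '' RP416.verticesOfCard 3} ∧
      (RP416.toQuotient '' (RP416.verticesOfCard 1 ∪ RP416.verticesOfCard 5)).ncard = 6 ∧
      (RP416.toQuotient '' RP416.verticesOfCard 3).ncard = 10 ∧
      ∃ P₁ P₂ : Set (Finset RP416.QuotientLabel),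
        {O | ∃ s ∈ RP416.facets RP416.quotientS432, O = Set.range fun g => s.map (ρ g).toEmbedding} =
          {P₁, P₂} ∧ P₁.ncard = 30 ∧ P₂.ncard = 120) ∧
    -- the quotient is the same complex as Lutz's
    RP416.Isomorphic RP416.quotientS432 RP416.lutzRP416 := by
  refine ⟨⟨RP416.point_singleton, RP416.point_antipode_singleton, fun i j k h =>
      ⟨RP416.point_triple h, RP416.point_antipode_triple h⟩, RP416.point_permLabel_apply⟩,
    ⟨RP416.vertices_X6, RP416.triangulatesByPoints_X6, RP416.simultaneousFlip_facetStarrings,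
      RP416.vertices_X12, RP416.triangulatesByPoints_X12, RP416.refinesByPoints_X12_X6⟩,
    ⟨RP416.vertices_X32, RP416.ncard_vertices_X32, RP416.triangulatesByPoints_X32,
      RP416.refinesByPoints_X32_X12, RP416.nonempty_homeomorph_sphere4_X32⟩,
    ⟨_, RP416.simultaneousFlip_firstFlips, RP416.simultaneousFlip_secondFlips⟩,
    ⟨RP416.vertices_S432.trans RP416.vertices_X32.symm, RP416.nonempty_homeomorph_sphere4_S432,
      ?_, ?_, ?_, ?_, ?_, ?_⟩,
    ⟨RP416.isAntipodal_S432, RP416.map_permLabel_S432, RP416.permLabel_compl⟩,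
    ⟨RP416.nonempty_homeomorph_realProjective4, RP416.ncard_vertices_quotientS432,
      RP416.ncard_facets_quotientS432, ?_⟩,
    ⟨RP416.quotientAction, RP416.quotientAction_toQuotient, RP416.map_quotientAction,
      RP416.quotientAction_faithful, RP416.vertexOrbits,
      RP416.ncard_toQuotient_verticesOfCard_one_five, RP416.ncard_toQuotient_verticesOfCard_three,
      _, _, RP416.facetOrbits, RP416.ncard_faceToQuotient_repStar,
      RP416.ncard_faceToQuotient_repFlipped⟩,
    RP416.isomorphic_lutzRP416⟩
  · rw [RP416.facets_S432, RP416.facets432_eq, RP416.facetType1_eq, RP416.facetType2_eq,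
      RP416.facetType3_eq, RP416.facetType4_eq]
  · rw [RP416.facetType1_eq, RP416.ncard_orbits_repStar]
  · rw [RP416.facetType2_eq, RP416.ncard_orbits_repMiddle]
  · rw [RP416.facetType3_eq, RP416.ncard_orbits_repFlipped]
  · rw [RP416.facetType4_eq, RP416.ncard_orbits_repVertex]
  · rw [RP416.facets_S432, RP416.ncard_facets432]
  · rw [RP416.facets_quotientS432]
    rintro _ ⟨F, hF, rfl⟩
    exact RP416.card_faceToQuotient hF
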